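/- All graphs are finite, simple, connected and non-empty; $n$ denotes the number of vertices. An instance consists of a graph $G$, a query cost function $c:V(G)\to\mathbb N$ and a weight function $w:V(G)\to\mathbb N$ (with $0\in\mathbb N$); for $X\subseteq V(G)$ write $c(X)=\sum_{v\in X}c(v)$ and $w(X)=\sum_{v\in X}w(v)$. Instances are given to algorithms by the adjacency matrix and by the costs and weights in binary. A decision tree $D$ for $(G,c,w)$ is a rooted tree on $V(G)$ describing a search for a hidden target $x$: when a vertex $q$ of the current (connected) candidate subgraph $H$ is queried, the search stops if $x=q$, and otherwise continues in the connected component of $H-q$ that contains $x$; the children of $q$ correspond one-to-one to the components of $H-q$. If $Q(D,x)$ is the sequence of queries made when the target is $x$ (the query to $x$ included), the cost of $D$ is $c_G(D)=\sum_{x\in V(G)}w(x)\sum_{q\in Q(D,x)}c(q)$. The Graph Search Problem asks for a decision tree of minimum cost $\mathrm{OPT}(G)$. A vertex cut is a partition $(A,S,B)$ of $V(G)$ (parts may be empty) with no edge between $A$ and $B$. The Min-Ratio Vertex Cut Problem asks, when $w(V(G))>0$, for a vertex cut with $w(A\cup S)\cdot w(B\cup S)\neq 0$ that minimizes the ratio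 $$\alpha_{c,w}(A,S,B)=\frac{c(S)}{w(A\cup S)\cdot w(B\cup S)}.$$ **Theorem.** Let $(f_n)_{n\ge 0}$ be real numbers, and suppose that there is a polynomial-time algorithm which, on every instance with $n$ vertices and $w(V(G))>0$, outputs a vertex cut of non-zero denominator whose ratio is at most $f_n$ times the minimum. Then there is a polynomial-time algorithm for the Graph Search Problem which, on every instance with $n$ vertices, outputs a decision tree $D$ with $$c_G(D)\le (12+4\sqrt5)\cdot f_n\cdot \mathrm{OPT}(G).$$ In particular, it is an $O(f_n)$-approximation algorithm. -/

import Mathlib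

/-! ## A programming language with a cost semantics

Programs compute on finite binary trees. Each program denotes a partial function from trees to trees.
The only primitive operations are the constant `nil`, the two projections, pairing, a test for
`nil`, and unbounded iteration. Every evaluation step is charged the size of the whole tree that it
reads, so that a computation of cost `t` is one of at most `t` steps on trees of total size at most
`t`. A Turing machine simulates it in time polynomial in `t`, and conversely one step of a
(multi-tape) Turing machine, its tapes being stored as lists, is a program of cost linear in the
size of the configuration. Hence polynomial cost is polynomial time. -/

/-- Finite binary trees, the data on which programs compute. -/
inductive Data : Type
  | nil : Data
  | cons : Data → Data → Data

namespace Data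

/-- The number of nodes of a tree, leaves included. -/
def size : Data → ℕ
  | nil => 1
  | cons x y => size x + size y + 1

/-- The left subtree. -/
def hd : Data → Data
  | nil => nil
  | cons x _ => x

/-- The right subtree. -/
def tl : Data → Data
  | nil => nil
  | cons _ y => y

/-- A list of trees as a tree. -/
def ofList : List Data → Data
  | [] => nil
  | x :: l => cons x (ofList l)

/-- A truth value as a tree. -/
def ofBool : Bool → Data
  | false => nil
  | true => cons nil nil

/-- A natural number as the list of its binary digits, the least significant one first. -/
def ofNat (k : ℕ) : Data :=
  ofList (k.bits.map ofBool)

/-- A vector of trees as a tree. -/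
def ofVec {n : ℕ} (a : Fin n → Data) : Data :=
  ofList (List.ofFn a)

open Classical in
/-- A set of vertices as the list of the values of its indicator function. -/
noncomputable def ofSet {n : ℕ} (s : Set (Fin n)) : Data :=
  ofVec fun i => ofBool (decide (i ∈ s))

/-- A binary relation as the list of the rows of its 0-1 matrix. -/
noncomputable def ofRel {n : ℕ} (r : Fin n → Fin n → Prop) : Data :=
  ofVec fun i => ofSet {j | r i j}

end Data

/-- Programs. `comp f g` runs `g` and then `f`; `pair f g` runs `f` and `g` on the same input and
pairs the results; `cond b f g` runs `f` if the result of `b` is not `nil`, and otherwise `g`;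
`loop b f` replaces its input by the result of `f` on it as long as the result of `b` on it is not
`nil`. -/
inductive Program : Type
  | id : Program
  | nil : Program
  | hd : Program
  | tl : Program
  | pair : Program → Program → Program
  | comp : Program → Program → Program
  | cond : Program → Program → Program → Program
  | loop : Program → Program → Program

namespace Program

/-- `Runs p x y t`: on input `x` the program `p` halts with output `y`, at cost `t`. -/
inductive Runs : Program → Data → Data → ℕ → Prop
  | id (x : Data) : Runs id x x x.size
  | nil (x : Data) : Runs nil x Data.nil x.size
  | hd (x : Data) : Runs hd x x.hd x.size
  | tl (x : Data) : Runs tl x x.tl x.size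
  | pair {f g : Program} {x y z : Data} {s t : ℕ} :
      Runs f x y s → Runs g x z t → Runs (pair f g) x (Data.cons y z) (x.size + s + t)
  | comp {f g : Program} {x y z : Data} {s t : ℕ} :
      Runs g x y s → Runs f y z t → Runs (comp f g) x z (x.size + s + t)
  | cond_then {b f g : Program} {x u y : Data} {r s : ℕ} :
      Runs b x u r → u ≠ Data.nil → Runs f x y s → Runs (cond b f g) x y (x.size + r + s)
  | cond_else {b f g : Program} {x y : Data} {r s : ℕ} :
      Runs b x Data.nil r → Runs g x y s → Runs (cond b f g) x y (x.size + r + s)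
  | loop_stop {b f : Program} {x : Data} {r : ℕ} :
      Runs b x Data.nil r → Runs (loop b f) x x (x.size + r)
  | loop_step {b f : Program} {x u y z : Data} {r s t : ℕ} :
      Runs b x u r → u ≠ Data.nil → Runs f x y s → Runs (loop b f) y z t →
      Runs (loop b f) x z (x.size + r + s + t)

end Program

/-! ## Decision trees -/

/-- A decision tree for the candidate set `H` in the graph `G`: it queries some vertex `q` of `H`
and has, for every connected component of the graph induced on `H \ {q}` (that is, for every
negative response), exactly one child, which is a decision tree for that component. -/
inductive DecisionTree {V : Type} (G : SimpleGraph V) : Set V → Type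
  | query {H : Set V} (q : V) (hq : q ∈ H)
      (next : ∀ K : (G.induce (H \ {q})).ConnectedComponent,
        DecisionTree G (Subtype.val '' K.supp)) : DecisionTree G H

namespace DecisionTree

open Classical in
/-- The sequence of queries made until the target `x ∈ H` is found, the query to `x` included. -/
noncomputable def queries {V : Type} {G : SimpleGraph V} :
    {H : Set V} → DecisionTree G H → V → List V
  | H, query q _ next, x =>
      q :: (if h : x ∈ H \ {q} then
        queries (next ((G.induce (H \ {q})).connectedComponentMk ⟨x, h⟩)) x else [])

/-- `D.IsParent y x`: the node `y` is the parent of the node `x` in the rooted tree `D`. -/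
def IsParent {V : Type} {G : SimpleGraph V} (D : DecisionTree G Set.univ) (y x : V) : Prop :=
  [y, x] <:+ D.queries x

/-- The weighted search cost of a decision tree for the whole graph. -/
noncomputable def cost {V : Type} [Fintype V] {G : SimpleGraph V} (c w : V → ℕ)
    (D : DecisionTree G Set.univ) : ℕ :=
  ∑ x : V, w x * ((D.queries x).map c).sum

/-- A decision tree as a tree of data: the 0-1 matrix whose entry `(x, y)` says whether `y` is the
parent of `x`. -/
noncomputable def encode {n : ℕ} {G : SimpleGraph (Fin n)} (D : DecisionTree G Set.univ) : Data :=
  Data.ofRel fun x y => D.IsParent y x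

end DecisionTree

/-! ## Vertex cuts -/

/-- A vertex cut: a partition of the vertices into three (possibly empty) sets such that no edge
joins the first to the last. -/
structure VertexCut {V : Type} [Fintype V] [DecidableEq V] (G : SimpleGraph V) where
  A : Finset V
  S : Finset V
  B : Finset V
  disjoint_A_S : Disjoint A S
  disjoint_A_B : Disjoint A B
  disjoint_S_B : Disjoint S B
  cover : A ∪ S ∪ B = Finset.univ
  not_adj : ∀ u ∈ A, ∀ v ∈ B, ¬ G.Adj u v

namespace VertexCut

/-- The denominator of the ratio of a vertex cut. -/
def denom {V : Type} [Fintype V] [DecidableEq V] {G : SimpleGraph V} (w : V → ℕ)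
    (X : VertexCut G) : ℕ :=
  (∑ v ∈ X.A ∪ X.S, w v) * (∑ v ∈ X.B ∪ X.S, w v)

/-- The ratio of a vertex cut; it is meaningful if the denominator is not zero. -/
noncomputable def ratio {V : Type} [Fintype V] [DecidableEq V] {G : SimpleGraph V} (c w : V → ℕ)
    (X : VertexCut G) : ℝ :=
  (∑ v ∈ X.S, c v : ℕ) / (X.denom w : ℝ)

/-- A vertex cut as a tree of data. -/
noncomputable def encode {n : ℕ} {G : SimpleGraph (Fin n)} (X : VertexCut G) : Data :=
  Data.cons (Data.ofSet (X.A : Set (Fin n)))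
    (Data.cons (Data.ofSet (X.S : Set (Fin n))) (Data.ofSet (X.B : Set (Fin n))))

end VertexCut

/-! ## Instances and approximation algorithms -/

/-- An instance (of either problem) with `n` vertices: a connected simple graph with query costs and
weights. -/
structure SearchInstance (n : ℕ) where
  G : SimpleGraph (Fin n)
  connected : G.Connected
  c : Fin n → ℕ
  w : Fin n → ℕ

namespace SearchInstance

/-- An instance as a tree of data: the adjacency matrix, then the costs and the weights in binary. -/
noncomputable def encode {n : ℕ} (I : SearchInstance n) : Data :=
  Data.cons (Data.ofRel I.G.Adj)
    (Data.cons (Data.ofVec fun v => Data.ofNat (I.c v)) (Data.ofVec fun v => Data.ofNat (I.w v)))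

/-- The minimum cost of a decision tree. -/
noncomputable def opt {n : ℕ} (I : SearchInstance n) : ℕ :=
  sInf {k : ℕ | ∃ D : DecisionTree I.G Set.univ, k = D.cost I.c I.w}

/-- The minimum ratio of a vertex cut whose ratio is defined. -/
noncomputable def minRatio {n : ℕ} (I : SearchInstance n) : ℝ :=
  sInf {r : ℝ | ∃ X : VertexCut I.G, X.denom I.w ≠ 0 ∧ r = X.ratio I.c I.w}

end SearchInstance

namespace Program

/-- The program halts on every instance, at a cost bounded by a polynomial in the size of the
encoded instance. -/
def PolyTime (p : Program) : Prop :=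
  ∃ P : Polynomial ℕ, ∀ (n : ℕ) (I : SearchInstance n),
    ∃ (y : Data) (t : ℕ), p.Runs I.encode y t ∧ t ≤ P.eval I.encode.size

/-- On every instance with `n` vertices that has a vertex cut of defined ratio (equivalently, whose
total weight is not zero), the program outputs such a vertex cut, of ratio at most `f n` times the
minimum. -/
def ApproximatesMinRatioVertexCut (p : Program) (f : ℕ → ℝ) : Prop :=
  ∀ (n : ℕ) (I : SearchInstance n), (∑ v, I.w v) ≠ 0 →
    ∃ (X : VertexCut I.G) (t : ℕ), p.Runs I.encode X.encode t ∧
      X.denom I.w ≠ 0 ∧ X.ratio I.c I.w ≤ f n * I.minRatio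

/-- On every instance with `n` vertices, the program outputs a decision tree of cost at most `g n`
times the minimum. -/
def ApproximatesGraphSearch (p : Program) (g : ℕ → ℝ) : Prop :=
  ∀ (n : ℕ) (I : SearchInstance n),
    ∃ (D : DecisionTree I.G Set.univ) (t : ℕ), p.Runs I.encode D.encode t ∧
      (D.cost I.c I.w : ℝ) ≤ g n * (I.opt : ℝ)

end Program

/-! The algorithm cuts recursively. For a pending set `H` of positive weight, the given program
proposes a cut `(A, S, B)` of the same graph with costs and weights set to zero outside `H`; the
vertices of `S` in `H` are queried next and the parts of `A` and `B` in `H` become pending. A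
pending set of weight zero is queried entirely. The instance keeps its `n` vertices and its
connected graph, so the factor is always `f n`, and no monotonicity of `f` enters. Only an order of
the vertices is recorded: the output tree always queries the earliest vertex of the candidate set. A
vertex emitted for `H` is queried only for targets in `H`, so the cost is at most the sum of all
c(S)·w(H).

To bound this sum, fix an optimal tree and call the weight of the targets for which it queries q the
load of q. Some query is common to all targets of a connected set, so a connected set without
vertices of load above t weighs at most t (`DecisionTree.mass_le_of_connectedIn`). Let r = w(H) and
let L be the vertices of `H` of load above r/2. The connected pieces of H \ L weigh at most r/2 and
can be grouped into two sides of weight at most 3r/4, which gives a cut of cost c(L) and denominator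
at least 3r²/16. The proposed cut therefore satisfies c(S)·r ≤ (16/3)·f(n)·x·c(L), where x is w(H)
minus the weight of the heavier of A and B.

This is paid by the budget of `H`, the sum over the layers t < w(H) of the cost of the vertices in
`H` of load above (t+1)/2. The layers below the weight of the heavier part suffice for both parts,
and the other x layers, each costing at least c(L), are released (`DecisionTree.budget_split`).
Telescoping bounds the cost by (16/3)·f(n) times the budget of the whole vertex set, which is at
most 2·OPT because q lies in at most twice its load many layers. The result, 32/3, is below 12 +
4√5.

The running time rests on closure properties of `Computes`, on a quadratic potential that bounds the
number of rounds, and on reading the tree off the order as a reachability relation. -/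

theorem Polynomial.eval_mono_nat (P : Polynomial ℕ) {a b : ℕ} (h : a ≤ b) :
    P.eval a ≤ P.eval b := by
  simp only [Polynomial.eval_eq_sum_range]
  gcongr

/-! ### Determinism and output size of runs -/

namespace Program

/-- The time bound and the quality of the cut are hypotheses about separate runs; determinism
identifies these runs. -/
theorem Runs.det {p : Program} {x y z : Data} {s t : ℕ} (h₁ : p.Runs x y s) (h₂ : p.Runs x z t) :
    y = z ∧ s = t := by
  induction h₁ generalizing z t with
  | id x => cases h₂; exact ⟨rfl, rfl⟩
  | nil x => cases h₂; exact ⟨rfl, rfl⟩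
  | hd x => cases h₂; exact ⟨rfl, rfl⟩
  | tl x => cases h₂; exact ⟨rfl, rfl⟩
  | pair _ _ ihf ihg =>
    cases h₂ with
    | pair hf hg =>
      obtain ⟨rfl, rfl⟩ := ihf hf
      obtain ⟨rfl, rfl⟩ := ihg hg
      exact ⟨rfl, rfl⟩
  | comp _ _ ihg ihf =>
    cases h₂ with
    | comp hg hf =>
      obtain ⟨rfl, rfl⟩ := ihg hg
      obtain ⟨rfl, rfl⟩ := ihf hf
      exact ⟨rfl, rfl⟩
  | cond_then _ hu _ ihb ihf =>
    cases h₂ with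
    | cond_then hb hu' hf =>
      obtain ⟨rfl, rfl⟩ := ihb hb
      obtain ⟨rfl, rfl⟩ := ihf hf
      exact ⟨rfl, rfl⟩
    | cond_else hb _ => exact absurd (ihb hb).1 hu
  | cond_else _ _ ihb ihg =>
    cases h₂ with
    | cond_then hb hu' _ => exact absurd (ihb hb).1.symm hu'
    | cond_else hb hg =>
      obtain ⟨-, rfl⟩ := ihb hb
      obtain ⟨rfl, rfl⟩ := ihg hg
      exact ⟨rfl, rfl⟩
  | loop_stop _ ihb =>
    cases h₂ with
    | loop_stop hb =>
      obtain ⟨-, rfl⟩ := ihb hb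
      exact ⟨rfl, rfl⟩
    | loop_step hb hu' _ _ => exact absurd (ihb hb).1.symm hu'
  | loop_step _ hu _ _ ihb ihf ihl =>
    cases h₂ with
    | loop_stop hb => exact absurd (ihb hb).1 hu
    | loop_step hb hu' hf hl =>
      obtain ⟨rfl, rfl⟩ := ihb hb
      obtain ⟨rfl, rfl⟩ := ihf hf
      obtain ⟨rfl, rfl⟩ := ihl hl
      exact ⟨rfl, rfl⟩

/-- Each step pays for the tree that it reads, and this also covers the node that `pair` adds. Hence
a cost bound for one program bounds the input of the next, and polynomial bounds compose. -/
theorem Runs.size_le {p : Program} {x y : Data} {t : ℕ} (h : p.Runs x y t) : y.size ≤ t := by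
  induction h with
  | id x => exact le_rfl
  | nil x => cases x <;> simp [Data.size]
  | hd x => cases x <;> simp [Data.size, Data.hd]; omega
  | tl x => cases x <;> simp [Data.size, Data.tl]; omega
  | @pair _ _ x _ _ _ _ _ _ ihf ihg =>
    have : 1 ≤ x.size := by cases x <;> simp [Data.size]
    simp only [Data.size]; omega
  | comp _ _ ihg ihf => omega
  | cond_then _ hu _ ihb ihf => omega
  | cond_else _ _ ihb ihg => omega
  | loop_stop _ ihb => omega
  | loop_step _ hu _ _ ihb ihf ihl => omega

end Program

/-! ### Encodings and their sizes -/

namespace Data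

open Classical in
/-- The truth value of a proposition as a tree. -/
noncomputable def ofProp (φ : Prop) : Data := ofBool (decide φ)

theorem ofProp_true {φ : Prop} (h : φ) : ofProp φ = cons nil nil := by simp [ofProp, h, ofBool]

theorem ofProp_false {φ : Prop} (h : ¬ φ) : ofProp φ = nil := by simp [ofProp, h, ofBool]

theorem ofProp_ne_nil {φ : Prop} : ofProp φ ≠ nil ↔ φ := by
  by_cases h : φ <;> simp [ofProp, h, ofBool]

theorem size_pos (x : Data) : 1 ≤ x.size := by cases x <;> simp [size]

theorem size_ofProp_le (φ : Prop) : (ofProp φ).size ≤ 3 := by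
  by_cases h : φ <;> simp [ofProp, h, ofBool, size]

/-- A natural number in unary notation. -/
def unary (k : ℕ) : Data := ofList (List.replicate k (cons nil nil))

theorem unary_succ (k : ℕ) : unary (k + 1) = cons (cons nil nil) (unary k) := rfl

theorem size_unary (k : ℕ) : (unary k).size = 4 * k + 1 := by
  induction k with
  | zero => rfl
  | succ k ih => simp only [unary_succ, size, ih]; omega

/-- The elements of the list that a tree represents. -/
def toList : Data → List Data
  | nil => []
  | cons x y => x :: toList y

theorem ofList_toList (x : Data) : ofList (toList x) = x := by
  induction x with
  | nil => rfl
  | cons x y _ ih => simp [toList, ofList, ih]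

theorem toList_ofList (l : List Data) : toList (ofList l) = l := by
  induction l with
  | nil => rfl
  | cons x l ih => simp [toList, ofList, ih]

theorem length_lt_size_ofList (l : List Data) : l.length < (ofList l).size := by
  induction l with
  | nil => simp [ofList, size]
  | cons x l ih => simp only [ofList, size, List.length_cons]; omega

theorem size_ofList_le (l : List Data) (b : ℕ) (h : ∀ x ∈ l, x.size ≤ b) :
    (ofList l).size ≤ l.length * (b + 1) + 1 := by
  induction l with
  | nil => simp [ofList, size]
  | cons x l ih =>
    have h₁ := h x (by simp)
    have h₂ := ih fun y hy => h y (by simp [hy])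
    simp only [ofList, size, List.length_cons]
    linarith [add_mul l.length 1 (b + 1)]

theorem size_ofVec_le {n : ℕ} (a : Fin n → Data) (b : ℕ) (h : ∀ i, (a i).size ≤ b) :
    (ofVec a).size ≤ n * (b + 1) + 1 := by
  have := size_ofList_le (List.ofFn a) b (by
    intro x hx
    obtain ⟨i, rfl⟩ := (List.mem_ofFn' _ _).1 hx
    exact h i)
  simpa [ofVec] using this

theorem ofSet_eq {n : ℕ} (s : Set (Fin n)) : ofSet s = ofVec fun i => ofProp (i ∈ s) := rfl

theorem size_ofSet_le {n : ℕ} (s : Set (Fin n)) : (ofSet s).size ≤ n * 4 + 1 :=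
  size_ofVec_le _ _ fun _ => size_ofProp_le _

theorem size_ofRel_le {n : ℕ} (r : Fin n → Fin n → Prop) :
    (ofRel r).size ≤ n * (n * 4 + 2) + 1 :=
  size_ofVec_le _ _ fun _ => size_ofSet_le _

end Data

/-! ### Closure properties of polynomial-time computation -/

open Data

/-- Some program computes `F a` from `e a` in time polynomial in the size of `e a`. -/
def Computes {α : Type} (e F : α → Data) : Prop :=
  ∃ (p : Program) (P : Polynomial ℕ), ∀ a, ∃ t, p.Runs (e a) (F a) t ∧ t ≤ P.eval (e a).size

/-- Some program decides `φ a` from `e a` in time polynomial in the size of `e a`. -/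
def Decides {α : Type} (e : α → Data) (φ : α → Prop) : Prop :=
  Computes e fun a => ofProp (φ a)

namespace Computes

variable {α β : Type} {e F F' : α → Data}

theorem size_le (h : Computes e F) :
    ∃ P : Polynomial ℕ, ∀ a, (F a).size ≤ P.eval (e a).size := by
  obtain ⟨p, P, h⟩ := h
  refine ⟨P, fun a => ?_⟩
  obtain ⟨t, h₁, h₂⟩ := h a
  exact h₁.size_le.trans h₂

theorem refl (e : α → Data) : Computes e e :=
  ⟨.id, .X, fun a => ⟨_, .id _, by simp⟩⟩

theorem restrict (h : Computes e F) (g : β → α) :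
    Computes (fun b => e (g b)) fun b => F (g b) := by
  obtain ⟨p, P, h⟩ := h
  exact ⟨p, P, fun b => h (g b)⟩

theorem trans (h₁ : Computes e F) (h₂ : Computes F F') : Computes e F' := by
  obtain ⟨p, P, hp⟩ := h₁
  obtain ⟨q, Q, hq⟩ := h₂
  refine ⟨.comp q p, .X + P + Q.comp P, fun a => ?_⟩
  obtain ⟨s, h₁, h₂⟩ := hp a
  obtain ⟨t, h₃, h₄⟩ := hq a
  refine ⟨_, .comp h₁ h₃, ?_⟩
  have := h₄.trans (Q.eval_mono_nat (h₁.size_le.trans h₂))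
  simp only [Polynomial.eval_add, Polynomial.eval_X, Polynomial.eval_comp]
  omega

theorem pair (h₁ : Computes e F) (h₂ : Computes e F') :
    Computes e fun a => cons (F a) (F' a) := by
  obtain ⟨p, P, hp⟩ := h₁
  obtain ⟨q, Q, hq⟩ := h₂
  refine ⟨.pair p q, .X + P + Q, fun a => ?_⟩
  obtain ⟨s, h₁, h₂⟩ := hp a
  obtain ⟨t, h₃, h₄⟩ := hq a
  refine ⟨_, .pair h₁ h₃, ?_⟩
  simp only [Polynomial.eval_add, Polynomial.eval_X]
  omega

theorem hd (h : Computes e F) : Computes e fun a => (F a).hd :=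
  h.trans ⟨.hd, .X, fun a => ⟨_, .hd _, by simp⟩⟩

theorem tl (h : Computes e F) : Computes e fun a => (F a).tl :=
  h.trans ⟨.tl, .X, fun a => ⟨_, .tl _, by simp⟩⟩

theorem nil (e : α → Data) : Computes e fun _ => Data.nil :=
  ⟨.nil, .X, fun a => ⟨_, .nil _, by simp⟩⟩

theorem const (e : α → Data) (d : Data) : Computes e fun _ => d := by
  induction d with
  | nil => exact nil e
  | cons x y hx hy => exact hx.pair hy

theorem cond_ne {f g : α → Data} (hb : Computes e F) (hf : Computes e f) (hg : Computes e g)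
    {k : α → Data} (h₁ : ∀ a, F a ≠ Data.nil → k a = f a) (h₂ : ∀ a, F a = Data.nil → k a = g a) :
    Computes e k := by
  obtain ⟨b, B, hb⟩ := hb
  obtain ⟨p, P, hp⟩ := hf
  obtain ⟨q, Q, hq⟩ := hg
  refine ⟨.cond b p q, .X + B + P + Q, fun a => ?_⟩
  obtain ⟨r, hb₁, hb₂⟩ := hb a
  simp only [Polynomial.eval_add, Polynomial.eval_X]
  by_cases h : F a = Data.nil
  · obtain ⟨t, h₃, h₄⟩ := hq a
    rw [h] at hb₁
    rw [h₂ a h]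
    exact ⟨_, .cond_else hb₁ h₃, by omega⟩
  · obtain ⟨t, h₃, h₄⟩ := hp a
    rw [h₁ a h]
    exact ⟨_, .cond_then hb₁ h h₃, by omega⟩

theorem ne_nil (h : Computes e F) : Decides e fun a => F a ≠ Data.nil :=
  cond_ne h (const e (cons .nil .nil)) (nil e) (fun _ h => ofProp_true h)
    fun _ h => ofProp_false (by simpa using h)

open Classical in
theorem ite {φ : α → Prop} (hφ : Decides e φ) (hF : Computes e F) (hF' : Computes e F') :
    Computes e fun a => if φ a then F a else F' a :=
  cond_ne hφ hF hF' (fun _ h => if_pos (ofProp_ne_nil.1 h))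
    fun _ h => if_neg fun h' => ofProp_ne_nil.2 h' h

/-- A loop whose number of iterations and whose states have polynomial size. -/
theorem while_loop {test : α → Prop} {step fin : α → α} {μ sz : α → ℕ} (Q R M : Polynomial ℕ)
    (htest : Decides e test)
    (hstep : Computes (fun a : {a // test a} => e a) fun a => e (step a))
    (hμ : ∀ a, test a → μ (step a) < μ a) (hsz : ∀ a, test a → sz (step a) ≤ sz a)
    (hQ : ∀ a, (e a).size ≤ Q.eval (sz a)) (hR : ∀ a, sz a ≤ R.eval (e a).size)
    (hM : ∀ a, μ a ≤ M.eval (sz a))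
    (h₀ : ∀ a, ¬ test a → fin a = a) (h₁ : ∀ a, test a → fin (step a) = fin a) :
    Computes e fun a => e (fin a) := by
  obtain ⟨b, B, hb⟩ := htest
  obtain ⟨f, P, hf⟩ := hstep
  dsimp only at hb hf
  -- `C` bounds the cost of one round in terms of `sz`, which never grows, whereas the encoding
  -- itself may grow during the loop.
  set C : Polynomial ℕ := Q + B.comp Q + P.comp Q with hC
  have key : ∀ m a, μ a ≤ m → ∃ t, (Program.loop b f).Runs (e a) (e (fin a)) t ∧
      t ≤ (m + 1) * C.eval (sz a) := by
    have hcost : ∀ a, (e a).size + B.eval (e a).size + P.eval (e a).size ≤ C.eval (sz a) := by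
      intro a
      have h₂ := B.eval_mono_nat (hQ a)
      have h₃ := P.eval_mono_nat (hQ a)
      have h₄ := hQ a
      simp only [hC, Polynomial.eval_add, Polynomial.eval_comp]
      omega
    intro m
    induction m with
    | zero =>
      intro a ha
      have hn : ¬ test a := fun h => by have := hμ a h; omega
      obtain ⟨r, hb₁, hb₂⟩ := hb a
      rw [ofProp_false hn] at hb₁
      rw [h₀ a hn]
      have := hcost a
      exact ⟨_, Program.Runs.loop_stop hb₁, by omega⟩
    | succ m ih =>
      intro a ha
      obtain ⟨r, hb₁, hb₂⟩ := hb a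
      have hc := hcost a
      by_cases h : test a
      · obtain ⟨t, ht, ht'⟩ := ih (step a) (by have := hμ a h; omega)
        obtain ⟨s, hs, hs'⟩ := hf ⟨a, h⟩
        rw [h₁ a h] at ht
        dsimp only at hs'
        refine ⟨_, .loop_step hb₁ (ofProp_ne_nil.2 h) hs ht, ?_⟩
        have h₅ : (m + 1) * C.eval (sz (step a)) ≤ (m + 1) * C.eval (sz a) :=
          Nat.mul_le_mul_left _ (C.eval_mono_nat (hsz a h))
        rw [add_mul (m + 1), one_mul]
        omega
      · rw [ofProp_false h] at hb₁
        rw [h₀ a h]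
        refine ⟨_, Program.Runs.loop_stop hb₁, ?_⟩
        rw [add_mul (m + 1), one_mul]
        have := Nat.zero_le ((m + 1) * C.eval (sz a))
        omega
  refine ⟨.loop b f, (M.comp R + 1) * C.comp R, fun a => ?_⟩
  obtain ⟨t, h₂, h₃⟩ := key _ a le_rfl
  refine ⟨t, h₂, h₃.trans ?_⟩
  simp only [Polynomial.eval_mul, Polynomial.eval_add, Polynomial.eval_comp, Polynomial.eval_one]
  exact Nat.mul_le_mul (Nat.add_le_add_right ((hM a).trans (M.eval_mono_nat (hR a))) 1)
    (C.eval_mono_nat (hR a))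

end Computes

/-- The context `e` extended by an index. -/
def ext {α : Type} (e : α → Data) (n : α → ℕ) (s : Σ a, Fin (n a)) : Data :=
  cons (e s.1) (unary s.2)

namespace Computes

variable {α β : Type} {e F F' : α → Data} {n : α → ℕ}

theorem fst (h : Computes e fun a => cons (F a) (F' a)) : Computes e F := h.hd

theorem snd (h : Computes e fun a => cons (F a) (F' a)) : Computes e F' := h.tl

theorem congr (h : Computes e F) (h' : ∀ a, F a = F' a) : Computes e F' :=
  funext h' ▸ h

theorem weaken (h : Computes e F) (n : α → ℕ) : Computes (ext e n) fun s => F s.1 :=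
  (refl (ext e n)).fst.trans (h.restrict Sigma.fst)

theorem index (e : α → Data) (n : α → ℕ) : Computes (ext e n) fun s => unary s.2 :=
  (refl (ext e n)).snd

/-- A loop over the indices below `n a`, from the last one to the first one. -/
theorem for_loop {S : α → ℕ → Data} (Q : Polynomial ℕ)
    (hn : Computes e fun a => unary (n a)) (h₀ : Computes e fun a => S a (n a))
    (hs : Computes (fun s : Σ a, Fin (n a) => cons (ext e n s) (S s.1 (s.2 + 1)))
      fun s => S s.1 s.2)
    (hQ : ∀ a, ∀ k ≤ n a, (S a k).size ≤ Q.eval (e a).size) :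
    Computes e fun a => S a 0 := by
  obtain ⟨N, hN⟩ := hn.size_le
  let β := Σ a, Fin (n a + 1)
  -- The loop carries the context, the index and the accumulated value. Counting down makes `tl` the
  -- decrement and lets lists be built from their ends.
  let e' : β → Data := fun b => cons (cons (e b.1) (unary b.2)) (S b.1 b.2)
  let step : β → β := fun b => ⟨b.1, ⟨b.2 - 1, by omega⟩⟩
  let fin : β → β := fun b => ⟨b.1, 0⟩
  have hk : ∀ b : β, (unary b.2).size ≤ N.eval (e b.1).size := fun b => by
    have h₁ := hN b.1
    have h₂ := b.2.2
    rw [size_unary] at h₁ ⊢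
    omega
  have main : Computes e' fun b => e' (fin b) := by
    refine while_loop (test := fun b => unary (b.2 : ℕ) ≠ Data.nil) (step := step)
      (μ := fun b => b.2) (sz := fun b => (e b.1).size) (.X + N + Q + 2) .X N
      (refl e').fst.snd.ne_nil ?_ ?_ (fun _ _ => le_rfl) ?_ ?_ ?_ ?_ (fun _ _ => rfl)
    · have hpos : ∀ b : {b : β // unary (b.2 : ℕ) ≠ Data.nil}, (b.1.2 : ℕ) - 1 + 1 = b.1.2 := by
        rintro ⟨⟨a, ⟨k, hk⟩⟩, h⟩
        cases k with
        | zero => exact absurd rfl h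
        | succ k => rfl
      let g : {b : β // unary (b.2 : ℕ) ≠ Data.nil} → Σ a, Fin (n a) := fun b =>
        ⟨b.1.1, ⟨b.1.2 - 1, by have := hpos b; have := b.1.2.2; omega⟩⟩
      have hr := (refl e').restrict (fun b : {b : β // unary (b.2 : ℕ) ≠ Data.nil} => b.1)
      have h₁ : Computes (fun b : {b : β // unary (b.2 : ℕ) ≠ Data.nil} => e' b)
          fun b => ext e n (g b) := by
        refine hr.fst.fst.pair (hr.fst.snd.tl.congr fun b => ?_)
        rw [← hpos b]
        rfl
      have h₂ : Computes (fun b : {b : β // unary (b.2 : ℕ) ≠ Data.nil} => e' b)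
          fun b => S (g b).1 (g b).2 := by
        refine Computes.trans ((h₁.pair hr.snd).congr fun b => ?_) (hs.restrict g)
        rw [show ((g b).2 : ℕ) + 1 = b.1.2 from hpos b]
      exact h₁.pair h₂
    · rintro ⟨a, ⟨k, hk⟩⟩ h
      cases k with
      | zero => exact absurd rfl h
      | succ k => exact Nat.lt_succ_self k
    · intro b
      have h₁ := hk b
      have h₂ := hQ b.1 b.2 (by omega)
      simp only [e', size, Polynomial.eval_add, Polynomial.eval_X]
      have : Polynomial.eval (e b.1).size (2 : Polynomial ℕ) = 2 := Polynomial.eval_ofNat _ _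
      omega
    · intro b
      simp only [e', size, Polynomial.eval_X]
      omega
    · intro b
      have h₁ := hk b
      rw [size_unary] at h₁
      show (b.2 : ℕ) ≤ _
      omega
    · rintro ⟨a, ⟨k, hk⟩⟩ h
      cases k with
      | zero => rfl
      | succ k => exact absurd (by simp [unary_succ]) h
  have h₁ := main.restrict fun a => (⟨a, Fin.last _⟩ : β)
  exact (((refl e).pair hn).pair h₀).trans h₁.snd

/-- The vector of the values of an expression with a free index. -/
theorem vec {F : (a : α) → Fin (n a) → Data} (hn : Computes e fun a => unary (n a))
    (h : Computes (ext e n) fun s => F s.1 s.2) : Computes e fun a => ofVec (F a) := by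
  obtain ⟨N, hN⟩ := hn.size_le
  obtain ⟨P, hP⟩ := h.size_le
  have hF : ∀ a i, (F a i).size ≤ P.eval ((e a).size + N.eval (e a).size + 1) := by
    intro a i
    refine (hP ⟨a, i⟩).trans (P.eval_mono_nat ?_)
    have h₁ := hN a
    have h₂ := i.2
    simp only [ext, size, size_unary] at h₁ ⊢
    omega
  refine (for_loop (S := fun a k => ofList ((List.ofFn (F a)).drop k))
    (N * (P.comp (.X + N + 1) + 1) + 1) hn ?_ ?_ ?_).congr fun a => rfl
  · exact (nil e).congr fun a => by rw [List.drop_of_length_le (by simp)]; rfl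
  · have h₁ := (refl fun s : Σ a, Fin (n a) =>
      cons (ext e n s) (ofList ((List.ofFn (F s.1)).drop (s.2 + 1))))
    refine ((h₁.fst.trans h).pair h₁.snd).congr fun s => ?_
    rw [List.drop_eq_getElem_cons (i := s.2) (by simp)]
    simp [ofList]
  · intro a k _
    refine (size_ofList_le _ (P.eval ((e a).size + N.eval (e a).size + 1)) fun x hx => ?_).trans ?_
    · obtain ⟨i, rfl⟩ := (List.mem_ofFn' _ _).1 (List.mem_of_mem_drop hx)
      exact hF a i
    · simp only [Polynomial.eval_add, Polynomial.eval_mul, Polynomial.eval_comp,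
        Polynomial.eval_X, Polynomial.eval_one, List.length_drop, List.length_ofFn]
      have := hN a
      rw [size_unary] at this
      gcongr
      omega

/-- List and index are shortened in parallel until the index is used up; `hd` of `nil` is the
default value. -/
theorem getD {l : α → List Data} {i : α → ℕ} (hl : Computes e fun a => ofList (l a))
    (hi : Computes e fun a => unary (i a)) : Computes e fun a => (l a).getD (i a) Data.nil := by
  let e' : List Data × ℕ → Data := fun b => cons (ofList b.1) (unary b.2)
  have main : Computes e' fun b => e' (b.1.drop b.2, 0) := by
    refine while_loop (test := fun b => unary b.2 ≠ Data.nil) (step := fun b => (b.1.tail, b.2 - 1))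
      (fin := fun b => (b.1.drop b.2, 0)) (μ := fun b => b.2) (sz := fun b => (e' b).size) .X .X .X
      (refl e').snd.ne_nil ?_ ?_ ?_ ?_ ?_ ?_ ?_ ?_
    · have hr := (refl e').restrict fun b : {b : List Data × ℕ // unary b.2 ≠ Data.nil} => b.1
      refine hr.fst.tl.pair hr.snd.tl |>.congr ?_
      rintro ⟨⟨l, k⟩, -⟩
      cases l <;> cases k <;> rfl
    · rintro ⟨l, k⟩ h
      cases k with
      | zero => exact absurd rfl h
      | succ k => exact Nat.lt_succ_self k
    · rintro ⟨l, k⟩ -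
      cases l <;> cases k <;> simp [e', ofList, size, size_unary] <;> omega
    · intro b; simp
    · intro b; simp
    · intro b
      simp only [e', Polynomial.eval_X, size, size_unary]
      omega
    · rintro ⟨l, k⟩ h
      cases k with
      | zero => rfl
      | succ k => exact absurd (by simp [unary_succ]) h
    · rintro ⟨l, k⟩ h
      cases k with
      | zero => exact absurd rfl h
      | succ k => simp
  refine ((hl.pair hi).trans (main.restrict fun a => (l a, i a)).fst.hd).congr fun a => ?_
  dsimp only
  rcases lt_or_ge (i a) (l a).length with h | h
  · rw [List.drop_eq_getElem_cons h, List.getD_eq_getElem _ _ h]; rfl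
  · rw [List.drop_of_length_le h, List.getD_eq_default _ _ h]; rfl

theorem get {v : (a : α) → Fin (n a) → Data} {i : (a : α) → Fin (n a)}
    (hv : Computes e fun a => ofVec (v a)) (hi : Computes e fun a => unary (i a)) :
    Computes e fun a => v a (i a) :=
  (getD hv hi).congr fun a => by simp

theorem length {l : α → List Data} (hl : Computes e fun a => ofList (l a)) :
    Computes e fun a => unary (l a).length := by
  let e' : List Data × ℕ → Data := fun b => cons (ofList b.1) (unary b.2)
  have main : Computes e' fun b => e' ([], b.2 + b.1.length) := by
    refine while_loop (test := fun b => ofList b.1 ≠ Data.nil) (step := fun b => (b.1.tail, b.2 + 1))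
      (fin := fun b => ([], b.2 + b.1.length)) (μ := fun b => b.1.length)
      -- Removing an element frees at least 2 nodes, but the unary counter gains 4. So the list is
      -- weighted by 4 and the counter only by 1.
      (sz := fun b => 4 * (e' b).size - 12 * b.2) (.X) (4 * .X) .X
      (refl e').fst.ne_nil ?_ ?_ ?_ ?_ ?_ ?_ ?_ ?_
    · have hr := (refl e').restrict fun b : {b : List Data × ℕ // ofList b.1 ≠ Data.nil} => b.1
      refine hr.fst.tl.pair ((const _ (cons .nil .nil)).pair hr.snd) |>.congr ?_
      rintro ⟨⟨l, k⟩, -⟩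
      cases l <;> rfl
    · rintro ⟨l, k⟩ h
      cases l with
      | nil => exact absurd rfl h
      | cons x l => exact Nat.lt_succ_self _
    · rintro ⟨l, k⟩ h
      cases l with
      | nil => exact absurd rfl h
      | cons x l =>
        have := x.size_pos
        simp only [e', ofList, size, size_unary, List.tail_cons]
        omega
    · intro b
      simp only [e', size, size_unary, Polynomial.eval_X]
      omega
    · intro b; simp
    · intro b
      have := length_lt_size_ofList b.1
      simp only [e', Polynomial.eval_X, size, size_unary]
      omega
    · rintro ⟨l, k⟩ h
      cases l with
      | nil => rfl
      | cons x l => exact absurd (by simp [ofList]) h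
    · rintro ⟨l, k⟩ h
      cases l with
      | nil => exact absurd rfl h
      | cons x l => simp; omega
  exact ((hl.pair (nil e)).trans (main.restrict fun a => (l a, 0)).snd).congr fun a => by simp

end Computes

namespace Decides

variable {α : Type} {e F : α → Data} {n : α → ℕ} {φ ψ : α → Prop}

theorem congr (h : Decides e φ) (h' : ∀ a, φ a ↔ ψ a) : Decides e ψ :=
  Computes.congr h fun a => by rw [propext (h' a)]

theorem weaken (h : Decides e φ) (n : α → ℕ) : Decides (ext e n) fun s => φ s.1 :=
  Computes.weaken h n

theorem not (h : Decides e φ) : Decides e fun a => ¬ φ a :=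
  Computes.cond_ne h (.nil e) (.const e (cons .nil .nil))
    (fun _ h => ofProp_false (not_not.2 (ofProp_ne_nil.1 h)))
    fun _ h => ofProp_true fun h' => ofProp_ne_nil.2 h' h

theorem and (h : Decides e φ) (h' : Decides e ψ) : Decides e fun a => φ a ∧ ψ a :=
  Computes.cond_ne h h' (.nil e)
    (fun a h => by simp [ofProp_ne_nil.1 h])
    fun a h => ofProp_false fun h' => ofProp_ne_nil.2 h'.1 h

theorem or (h : Decides e φ) (h' : Decides e ψ) : Decides e fun a => φ a ∨ ψ a :=
  (h.not.and h'.not).not.congr fun a => by tauto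

theorem imp (h : Decides e φ) (h' : Decides e ψ) : Decides e fun a => φ a → ψ a :=
  (h.not.or h').congr fun a => by tauto

theorem ex {φ : (a : α) → Fin (n a) → Prop} (hn : Computes e fun a => unary (n a))
    (h : Decides (ext e n) fun s => φ s.1 s.2) : Decides e fun a => ∃ i, φ a i := by
  refine (Computes.for_loop (S := fun a k => ofProp (∃ i : Fin (n a), k ≤ (i : ℕ) ∧ φ a i)) 3 hn
    ?_ ?_ ?_).congr fun a => by simp
  · exact (Computes.nil e).congr fun a => (ofProp_false fun ⟨i, hi, _⟩ => by omega).symm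
  · have h₁ := (Computes.refl fun s : Σ a, Fin (n a) =>
      cons (ext e n s) (ofProp (∃ i : Fin (n s.1), (s.2 : ℕ) + 1 ≤ i ∧ φ s.1 i)))
    refine Decides.congr (or (h₁.fst.trans h) h₁.snd) fun s => ⟨?_, ?_⟩
    · rintro (h | ⟨i, hi, h⟩)
      · exact ⟨s.2, le_rfl, h⟩
      · exact ⟨i, by omega, h⟩
    · rintro ⟨i, hi, h⟩
      rcases hi.eq_or_lt with hi | hi
      · exact Or.inl (by rwa [show s.2 = i from Fin.ext hi])
      · exact Or.inr ⟨i, hi, h⟩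
  · intro a k _
    have : Polynomial.eval (e a).size (3 : Polynomial ℕ) = 3 := Polynomial.eval_ofNat _ _
    rw [this]
    exact size_ofProp_le _

/-- The unary form of `j` is a list of `j` entries different from `nil`, so looking up entry `i`
succeeds exactly if `i < j`. -/
theorem lt {i j : α → ℕ} (hi : Computes e fun a => unary (i a))
    (hj : Computes e fun a => unary (j a)) : Decides e fun a => i a < j a :=
  (Computes.getD (l := fun a => List.replicate (j a) (cons .nil .nil)) hj hi).ne_nil.congr
    fun a => by
      rcases lt_or_ge (i a) (j a) with h | h
      · simp [h]
      · simp [h]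

theorem eq {i j : (a : α) → Fin (n a)} (hi : Computes e fun a => unary (i a))
    (hj : Computes e fun a => unary (j a)) : Decides e fun a => i a = j a :=
  ((lt hi hj).not.and (lt hj hi).not).congr fun a => by rw [Fin.ext_iff]; omega

theorem mem {s : (a : α) → Set (Fin (n a))} {i : (a : α) → Fin (n a)}
    (hs : Computes e fun a => ofSet (s a)) (hi : Computes e fun a => unary (i a)) :
    Decides e fun a => i a ∈ s a :=
  Computes.get hs hi

theorem rel {r : (a : α) → Fin (n a) → Fin (n a) → Prop} {i j : (a : α) → Fin (n a)}
    (hr : Computes e fun a => ofRel (r a)) (hi : Computes e fun a => unary (i a))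
    (hj : Computes e fun a => unary (j a)) : Decides e fun a => r a (i a) (j a) :=
  mem (s := fun a => {j | r a (i a) j}) (Computes.get hr hi) hj

theorem set {φ : (a : α) → Fin (n a) → Prop} (hn : Computes e fun a => unary (n a))
    (h : Decides (ext e n) fun s => φ s.1 s.2) : Computes e fun a => ofSet {i | φ a i} :=
  Computes.vec hn h

theorem ofRel {φ : (a : α) → Fin (n a) → Fin (n a) → Prop} (hn : Computes e fun a => unary (n a))
    (h : Decides (ext (ext e n) fun s => n s.1) fun s => φ s.1.1 s.1.2 s.2) :
    Computes e fun a => Data.ofRel (φ a) :=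
  Computes.vec hn (set (φ := fun (s : Σ a, Fin (n a)) => φ s.1 s.2) (hn.weaken n) h)

end Decides

/-! ### The recursive decomposition -/

namespace SearchInstance

variable {n : ℕ}

/-- The instance with costs and weights set to zero outside a set. -/
noncomputable def restrict (I : SearchInstance n) (H : Set (Fin n)) : SearchInstance n :=
  { I with c := H.indicator I.c, w := H.indicator I.w }

end SearchInstance

/-- The vertices of `H` that are marked in a list of data. -/
def markedIn {n : ℕ} (H : Set (Fin n)) (d : Data) : Set (Fin n) :=
  {v | v ∈ H ∧ d.toList.getD v Data.nil ≠ Data.nil}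

/-- A state of the recursive decomposition: the vertex sets that remain to be decomposed, the set of
vertices that have been ordered, and their order. -/
structure SearchState (n : ℕ) where
  todo : List (Set (Fin n))
  done : Set (Fin n)
  before : Fin n → Fin n → Prop

namespace SearchState

variable {n : ℕ}

/-- The state before the first step. -/
def init (n : ℕ) : SearchState n := ⟨[Set.univ], ∅, fun _ _ => False⟩

/-- The set that is decomposed next. -/
def current (s : SearchState n) : Set (Fin n) := s.todo.headD ∅

/-- The set that is decomposed next has a positive weight. -/
def Heavy (I : SearchInstance n) (s : SearchState n) : Prop := ∃ v, v ∈ s.current ∧ I.w v ≠ 0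

/-- The vertices of the current set that are ordered next, if `y` describes a vertex cut. -/
def emitted (I : SearchInstance n) (y : Data) (s : SearchState n) : Set (Fin n) :=
  {v | v ∈ s.current ∧ (s.Heavy I → v ∈ markedIn s.current y.tl.hd)}

open Classical in
/-- One step of the decomposition, along the vertex cut that `out` proposes. -/
noncomputable def step (out : (Σ n, SearchInstance n) → Data) (I : SearchInstance n)
    (s : SearchState n) : SearchState n :=
  let y := out ⟨n, I.restrict s.current⟩
  { todo :=
      if s.Heavy I then markedIn s.current y.hd :: markedIn s.current y.tl.tl :: s.todo.tail
      else s.todo.tail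
    done := {v | v ∈ s.done ∨ v ∈ s.emitted I y}
    before := fun u v =>
      s.before u v ∨ (u ∈ s.emitted I y ∧ v ∉ s.done ∧ (v ∈ s.emitted I y → u < v)) }

/-- A state, together with its instance, as a tree of data. -/
noncomputable def encode (a : Σ n, SearchInstance n × SearchState n) : Data :=
  cons a.2.1.encode (cons (ofList (a.2.2.todo.map ofSet))
    (cons (ofSet a.2.2.done) (ofRel a.2.2.before)))

end SearchState

/-- One round of the search for the vertices reachable from `y` through vertices that `lt` puts
after `y`. -/
def expand {n : ℕ} (adj lt R : Fin n → Fin n → Prop) (y x : Fin n) : Prop :=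
  R y x ∨ ∃ z, R y z ∧ adj z x ∧ lt y x

/-- `y` is the last vertex that is related to `x`, other than `x`. -/
def lastBefore {n : ℕ} (lt R : Fin n → Fin n → Prop) (x y : Fin n) : Prop :=
  R y x ∧ y ≠ x ∧ ¬ ∃ z, R z x ∧ z ≠ x ∧ lt y z

theorem Data.ofNat_ne_nil {k : ℕ} : ofNat k ≠ Data.nil ↔ k ≠ 0 := by
  constructor
  · rintro h rfl
    exact h (by simp [ofNat, ofList])
  · intro h h'
    have h₁ : k.bits = [] := by
      unfold ofNat at h'
      cases hb : k.bits with
      | nil => rfl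
      | cons b l => rw [hb] at h'; simp [ofList] at h'
    have := Nat.size_eq_bits_len k
    rw [h₁] at this
    exact h (Nat.size_eq_zero.1 this.symm)

/-! ### One step of the decomposition and the extraction of the tree in polynomial time -/

namespace Computes

open SearchState

section

variable {α : Type} {e : α → Data} {n : α → ℕ}

/-- The number of vertices is not written in the input; it is recovered as the number of rows of the
matrix. -/
theorem size_of_ofRel {r : (a : α) → Fin (n a) → Fin (n a) → Prop}
    (h : Computes e fun a => ofRel (r a)) : Computes e fun a => unary (n a) :=
  (length h).congr fun a => by simp

theorem markedIn {H : (a : α) → Set (Fin (n a))} {d : α → Data}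
    (hn : Computes e fun a => unary (n a)) (hH : Computes e fun a => ofSet (H a))
    (hd : Computes e d) : Computes e fun a => ofSet (_root_.markedIn (H a) (d a)) :=
  Decides.set hn ((Decides.mem (hH.weaken n) (index e n)).and
    (getD ((hd.congr fun a => (ofList_toList (d a)).symm).weaken n) (index e n)).ne_nil)

theorem restrict_instance {I : (a : α) → SearchInstance (n a)} {H : (a : α) → Set (Fin (n a))}
    (hI : Computes e fun a => (I a).encode) (hH : Computes e fun a => ofSet (H a)) :
    Computes e fun a => ((I a).restrict (H a)).encode := by
  have hn := size_of_ofRel hI.fst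
  have key : ∀ {c : (a : α) → Fin (n a) → ℕ}, Computes e (fun a => ofVec fun v => ofNat (c a v)) →
      Computes e fun a => ofVec fun v => ofNat ((H a).indicator (c a) v) := by
    intro c hc
    refine vec hn ((ite (Decides.mem (hH.weaken n) (index e n))
      (get (hc.weaken n) (index e n)) (Computes.nil _)).congr fun s => ?_)
    by_cases h : s.2 ∈ H s.1 <;> simp [h, ofNat, ofList]
  exact hI.fst.pair ((key hI.snd.fst).pair (key hI.snd.snd))

theorem expand {adj lt R : (a : α) → Fin (n a) → Fin (n a) → Prop}
    (ha : Computes e fun a => ofRel (adj a)) (hl : Computes e fun a => ofRel (lt a))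
    (hR : Computes e fun a => ofRel (R a)) :
    Computes e fun a => ofRel (_root_.expand (adj a) (lt a) (R a)) := by
  have hn := size_of_ofRel ha
  have hn₁ := hn.weaken n
  have hn₂ := hn₁.weaken fun s => n s.1
  have hy := (index e n).weaken fun s => n s.1
  have hx := index (ext e n) fun s => n s.1
  -- `w₁` and `w₂` move an expression into the contexts with two and with three free indices.
  have w₁ := fun {F : α → Data} (h : Computes e F) => (h.weaken n).weaken fun s => n s.1
  have w₂ := fun {F : α → Data} (h : Computes e F) => (w₁ h).weaken fun s => n s.1.1
  have hz := index (ext (ext e n) fun s => n s.1) fun s => n s.1.1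
  have hy' := hy.weaken fun s => n s.1.1
  have hx' := hx.weaken fun s => n s.1.1
  exact Decides.ofRel hn ((Decides.rel (w₁ hR) hy hx).or (Decides.ex hn₂
    ((Decides.rel (w₂ hR) hy' hz).and ((Decides.rel (w₂ ha) hz hx').and
      (Decides.rel (w₂ hl) hy' hx')))))

theorem iterate_expand {adj lt : (a : α) → Fin (n a) → Fin (n a) → Prop}
    (ha : Computes e fun a => ofRel (adj a)) (hl : Computes e fun a => ofRel (lt a)) :
    Computes e fun a => ofRel ((_root_.expand (adj a) (lt a))^[n a] Eq) := by
  have hn := size_of_ofRel ha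
  obtain ⟨N, hN⟩ := hn.size_le
  refine (for_loop (S := fun a k => ofRel ((_root_.expand (adj a) (lt a))^[n a - k] Eq))
    (N * (N * 4 + 2) + 1) hn ?_ ?_ ?_).congr fun a => by simp
  · have := Decides.ofRel (φ := fun a => (Eq : Fin (n a) → Fin (n a) → Prop)) hn
      (Decides.eq ((index e n).weaken fun s => n s.1) (index (ext e n) fun s => n s.1))
    exact this.congr fun a => by simp
  · have h₁ := refl fun s : Σ a, Fin (n a) => cons (ext e n s)
      (ofRel ((_root_.expand (adj s.1) (lt s.1))^[n s.1 - (s.2 + 1)] Eq))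
    have h₂ := expand (h₁.fst.trans (ha.weaken n)) (h₁.fst.trans (hl.weaken n)) h₁.snd
    refine h₂.congr fun s => ?_
    rw [← Function.iterate_succ_apply' (_root_.expand (adj s.1) (lt s.1))]
    congr 2
    have := s.2.2
    omega
  · intro a k _
    refine (size_ofRel_le _).trans ?_
    have h₁ := hN a
    rw [size_unary] at h₁
    have h₂ : n a ≤ N.eval (e a).size := by omega
    have h₃ : Polynomial.eval (e a).size (4 : Polynomial ℕ) = 4 := Polynomial.eval_ofNat _ _
    have h₄ : Polynomial.eval (e a).size (2 : Polynomial ℕ) = 2 := Polynomial.eval_ofNat _ _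
    simp only [Polynomial.eval_add, Polynomial.eval_mul, Polynomial.eval_one, h₃, h₄]
    gcongr

theorem lastBefore {lt R : (a : α) → Fin (n a) → Fin (n a) → Prop}
    (hl : Computes e fun a => ofRel (lt a)) (hR : Computes e fun a => ofRel (R a)) :
    Computes e fun a => ofRel (_root_.lastBefore (lt a) (R a)) := by
  have hn := size_of_ofRel hl
  have hn₂ := (hn.weaken n).weaken fun s => n s.1
  have hx := (index e n).weaken fun s => n s.1
  have hy := index (ext e n) fun s => n s.1
  have w₁ := fun {F : α → Data} (h : Computes e F) => (h.weaken n).weaken fun s => n s.1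
  have w₂ := fun {F : α → Data} (h : Computes e F) => (w₁ h).weaken fun s => n s.1.1
  have hz := index (ext (ext e n) fun s => n s.1) fun s => n s.1.1
  have hy' := hy.weaken fun s => n s.1.1
  have hx' := hx.weaken fun s => n s.1.1
  exact Decides.ofRel hn ((Decides.rel (w₁ hR) hy hx).and ((Decides.eq hy hx).not.and
    (Decides.ex hn₂ ((Decides.rel (w₂ hR) hz hx').and ((Decides.eq hz hx').not.and
      (Decides.rel (w₂ hl) hy' hz)))).not))

end

theorem step {out : (Σ n, SearchInstance n) → Data}
    (hout : Computes (fun I : Σ n, SearchInstance n => I.2.encode) out) :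
    Computes (fun a : {a : Σ n, SearchInstance n × SearchState n // a.2.2.todo ≠ []} => encode a)
      fun a => encode ⟨a.1.1, a.1.2.1, a.1.2.2.step out a.1.2.1⟩ := by
  set e := fun a : {a : Σ n, SearchInstance n × SearchState n // a.2.2.todo ≠ []} =>
    encode a.1 with he
  let n := fun a : {a : Σ n, SearchInstance n × SearchState n // a.2.2.todo ≠ []} => a.1.1
  have hI : Computes e fun a => a.1.2.1.encode := (refl e).fst
  have htodo : Computes e fun a => ofList (a.1.2.2.todo.map ofSet) := (refl e).snd.fst
  have hdone : Computes e fun a => ofSet a.1.2.2.done := (refl e).snd.snd.fst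
  have hbefore : Computes e fun a => ofRel a.1.2.2.before := (refl e).snd.snd.snd
  have hn : Computes e fun a => unary a.1.1 := size_of_ofRel hI.fst
  -- On an empty list `hd` would return `nil`, not the encoding of `∅` as a list of `n` entries;
  -- hence the restriction to states with a pending set.
  have hH : Computes e fun a => ofSet a.1.2.2.current := htodo.hd.congr fun a => by
    obtain ⟨⟨n, I, ⟨todo, done, before⟩⟩, h⟩ := a
    cases todo with
    | nil => exact absurd rfl h
    | cons H T => rfl
  have htail : Computes e fun a => ofList (a.1.2.2.todo.tail.map ofSet) :=
    htodo.tl.congr fun a => by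
      obtain ⟨⟨n, I, ⟨todo, done, before⟩⟩, h⟩ := a
      cases todo with
      | nil => exact absurd rfl h
      | cons H T => rfl
  have hheavy : Decides e fun a => a.1.2.2.Heavy a.1.2.1 :=
    Decides.ex hn ((Decides.mem (hH.weaken n) (index e n)).and
      ((get (v := fun s : Σ a, Fin (n a) => fun v => ofNat (s.1.1.2.1.w v))
        (hI.snd.snd.weaken n) (index e n)).ne_nil.congr fun s => ofNat_ne_nil))
  -- The proposal is computed for sets of weight zero as well, where it is ignored; the program
  -- halts on those instances too.
  have hy : Computes e fun a => out ⟨a.1.1, a.1.2.1.restrict a.1.2.2.current⟩ :=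
    (restrict_instance hI hH).trans (hout.restrict
      fun a : {a : Σ n, SearchInstance n × SearchState n // a.2.2.todo ≠ []} =>
        (⟨a.1.1, a.1.2.1.restrict a.1.2.2.current⟩ : Σ n, SearchInstance n))
  have hS : Computes e fun a => ofSet (a.1.2.2.emitted a.1.2.1
      (out ⟨a.1.1, a.1.2.1.restrict a.1.2.2.current⟩)) :=
    Decides.set hn ((Decides.mem (hH.weaken n) (index e n)).and ((hheavy.weaken n).imp
      (Decides.mem ((markedIn hn hH hy.tl.hd).weaken n) (index e n))))
  refine hI.pair (Computes.pair ?_ (Computes.pair ?_ ?_))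
  · refine (ite hheavy ((markedIn hn hH hy.hd).pair ((markedIn hn hH hy.tl.tl).pair htail))
      htail).congr fun a => ?_
    by_cases h : a.1.2.2.Heavy a.1.2.1 <;> simp [SearchState.step, h, ofList]
  · exact Decides.set hn ((Decides.mem (hdone.weaken n) (index e n)).or
      (Decides.mem (hS.weaken n) (index e n)))
  · have hu := (index e n).weaken fun s => n s.1
    have hv := index (ext e n) fun s => n s.1
    have w₁ := fun {F : _ → Data} (h : Computes e F) => (h.weaken n).weaken fun s => n s.1
    exact Decides.ofRel hn ((Decides.rel (w₁ hbefore) hu hv).or ((Decides.mem (w₁ hS) hu).and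
      ((Decides.mem (w₁ hdone) hv).not.and ((Decides.mem (w₁ hS) hv).imp (Decides.lt hu hv)))))

theorem init : Computes (fun I : Σ n, SearchInstance n => I.2.encode)
    fun I => encode ⟨I.1, I.2, SearchState.init I.1⟩ := by
  have hI := refl fun I : Σ n, SearchInstance n => I.2.encode
  have hn : Computes _ fun I : Σ n, SearchInstance n => unary I.1 := size_of_ofRel hI.fst
  have ht := fun (β : Type) (e : β → Data) => (const e (cons .nil .nil)).congr
    fun _ => (ofProp_true trivial).symm
  have hf := fun (β : Type) (e : β → Data) => (nil e).congr fun _ => (ofProp_false id).symm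
  exact hI.pair (((Decides.set (φ := fun _ _ => True) hn (ht _ _)).pair (nil _)).pair
    ((Decides.set (φ := fun _ _ => False) hn (hf _ _)).pair
      (Decides.ofRel (φ := fun _ _ _ => False) hn (hf _ _))))

end Computes

/-! ### Iteration and the cuts extracted from the given program -/

/-- Iterates a function until a test fails. -/
noncomputable def iterateUntil {α : Type} (test : α → Prop) (step : α → α) (μ : α → ℕ)
    (h : ∀ a, test a → μ (step a) < μ a) (a : α) : α :=
  open Classical in if _ha : test a then iterateUntil test step μ h (step a) else a
termination_by μ a
decreasing_by exact h a _ha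

section

variable {α : Type} {test : α → Prop} {step : α → α} {μ : α → ℕ}
  {h : ∀ a, test a → μ (step a) < μ a} {a : α}

theorem iterateUntil_of_not (ha : ¬ test a) : iterateUntil test step μ h a = a := by
  rw [iterateUntil, dif_neg ha]

theorem iterateUntil_step (ha : test a) :
    iterateUntil test step μ h (step a) = iterateUntil test step μ h a := by
  conv_rhs => rw [iterateUntil, dif_pos ha]

theorem iterateUntil_spec {P : α → Prop} (hP : ∀ a, test a → P a → P (step a)) (ha : P a) :
    P (iterateUntil test step μ h a) ∧ ¬ test (iterateUntil test step μ h a) := by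
  induction hm : μ a using Nat.strong_induction_on generalizing a with
  | _ m ih =>
    by_cases ht : test a
    · rw [← iterateUntil_step ht]
      exact ih _ (hm ▸ h a ht) (hP a ht ha) rfl
    · rw [iterateUntil_of_not ht]
      exact ⟨ha, ht⟩

end

/-- Whenever the total weight is not zero, `out` proposes a vertex cut whose ratio is at most `f n`
times the minimum. -/
def ProposesCuts (out : (Σ n, SearchInstance n) → Data) (f : ℕ → ℝ) : Prop :=
  ∀ (n : ℕ) (I : SearchInstance n), (∑ v, I.w v) ≠ 0 → ∃ X : VertexCut I.G,
    out ⟨n, I⟩ = X.encode ∧ X.denom I.w ≠ 0 ∧ X.ratio I.c I.w ≤ f n * I.minRatio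

theorem Program.exists_computes_proposesCuts {p : Program} {f : ℕ → ℝ} (hp : p.PolyTime)
    (hf : p.ApproximatesMinRatioVertexCut f) : ∃ out : (Σ n, SearchInstance n) → Data,
      Computes (fun I : Σ n, SearchInstance n => I.2.encode) out ∧ ProposesCuts out f := by
  obtain ⟨P, hP⟩ := hp
  choose out t hout using fun I : Σ n, SearchInstance n => hP I.1 I.2
  refine ⟨out, ⟨p, P, fun I => ⟨t I, hout I⟩⟩, fun n I hI => ?_⟩
  obtain ⟨X, s, h₁, h₂, h₃⟩ := hf n I hI
  exact ⟨X, ((hout ⟨n, I⟩).1.det h₁).1, h₂, h₃⟩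

/-! ### Weights of vertex sets -/

section mass

variable {V : Type} [Fintype V]

/-- The sum of a function over a set of vertices. -/
noncomputable def mass (w : V → ℕ) (H : Set V) : ℕ := ∑ v, H.indicator w v

variable {w : V → ℕ} {H K : Set V}

theorem mass_mono (h : H ⊆ K) : mass w H ≤ mass w K :=
  Finset.sum_le_sum fun v _ => Set.indicator_le_indicator_of_subset h (fun _ => Nat.zero_le _) v

theorem mass_union (h : Disjoint H K) : mass w (H ∪ K) = mass w H + mass w K := by
  simp [mass, Set.indicator_union_of_disjoint h, Finset.sum_add_distrib]

theorem mass_empty : mass w (∅ : Set V) = 0 := by simp [mass]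

theorem mass_ne_zero : mass w H ≠ 0 ↔ ∃ v, v ∈ H ∧ w v ≠ 0 := by
  simp [mass]

theorem sum_indicator_eq_mass (F : Finset V) :
    ∑ v ∈ F, H.indicator w v = mass w (H ∩ F) := by
  rw [mass, ← Finset.sum_subset (Finset.subset_univ F)]
  · exact Finset.sum_congr rfl fun v hv => by
      classical
      simp [Set.indicator_apply, hv]
  · intro v _ hv
    simp [hv]

end mass

theorem markedIn_ofSet {n : ℕ} (H X : Set (Fin n)) : markedIn H (ofSet X) = H ∩ X := by
  ext v
  simp only [markedIn, ofSet_eq, ofVec, toList_ofList, Set.mem_ofPred_eq, Set.mem_inter_iff]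
  rw [List.getD_eq_getElem _ _ (by simp)]
  simp [ofProp_ne_nil]

/-! ### Effect of one step and termination -/

namespace SearchState

variable {n : ℕ} {I : SearchInstance n} {out : (Σ n, SearchInstance n) → Data} {f : ℕ → ℝ}
  {s : SearchState n}

theorem heavy_iff : s.Heavy I ↔ mass I.w s.current ≠ 0 := mass_ne_zero.symm

/-- The sets that a step makes of a set of positive weight. -/
theorem exists_split (hout : ProposesCuts out f) (hs : s.Heavy I) :
    ∃ A S B : Set (Fin n), A ∪ S ∪ B = s.current ∧ Disjoint A S ∧ Disjoint A B ∧ Disjoint S B ∧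
      (∀ u ∈ A, ∀ v ∈ B, ¬ I.G.Adj u v) ∧
      (s.step out I).todo = A :: B :: s.todo.tail ∧
      s.emitted I (out ⟨n, I.restrict s.current⟩) = S ∧
      mass I.w (A ∪ S) * mass I.w (B ∪ S) ≠ 0 ∧
      (mass I.c S : ℝ) / (mass I.w (A ∪ S) * mass I.w (B ∪ S) : ℕ) ≤
        f n * (I.restrict s.current).minRatio := by
  set H := s.current with hH
  obtain ⟨X, h₁, h₂, h₃⟩ := hout n (I.restrict H) (heavy_iff.1 hs)
  have hc : ∀ v, v ∈ X.A ∨ v ∈ X.S ∨ v ∈ X.B := fun v => by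
    have := X.cover ▸ Finset.mem_univ v
    simpa [or_assoc] using this
  have hd : X.denom (I.restrict H).w =
      mass I.w (H ∩ X.A ∪ H ∩ X.S) * mass I.w (H ∩ X.B ∪ H ∩ X.S) := by
    change (∑ v ∈ X.A ∪ X.S, H.indicator I.w v) * (∑ v ∈ X.B ∪ X.S, H.indicator I.w v) = _
    rw [sum_indicator_eq_mass, sum_indicator_eq_mass]
    simp [Set.inter_union_distrib_left]
  rw [hd] at h₂
  rw [VertexCut.ratio, hd] at h₃
  change ((∑ v ∈ X.S, H.indicator I.c v : ℕ) : ℝ) / _ ≤ _ at h₃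
  rw [sum_indicator_eq_mass] at h₃
  refine ⟨H ∩ X.A, H ∩ X.S, H ∩ X.B, ?_, ?_, ?_, ?_, ?_, ?_, ?_, h₂, h₃⟩
  · ext v
    have := hc v
    simp only [Set.mem_union, Set.mem_inter_iff, Finset.mem_coe]
    tauto
  · exact (Finset.disjoint_coe.2 X.disjoint_A_S).mono Set.inter_subset_right Set.inter_subset_right
  · exact (Finset.disjoint_coe.2 X.disjoint_A_B).mono Set.inter_subset_right Set.inter_subset_right
  · exact (Finset.disjoint_coe.2 X.disjoint_S_B).mono Set.inter_subset_right Set.inter_subset_right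
  · exact fun u hu v hv => X.not_adj u hu.2 v hv.2
  · simp only [step, if_pos hs, ← hH]
    rw [h₁]
    simp only [VertexCut.encode, Data.hd, tl, markedIn_ofSet]
  · ext v
    simp only [emitted, hs, h₁, VertexCut.encode, Data.hd, tl, markedIn_ofSet, forall_const, ← hH]
    simp

theorem emitted_of_not_heavy (hs : ¬ s.Heavy I) (y : Data) : s.emitted I y = s.current := by
  ext v
  simp [emitted, hs]

theorem step_todo_of_not_heavy (hs : ¬ s.Heavy I) : (s.step out I).todo = s.todo.tail := by
  simp [step, hs]

/-- A measure for the number of steps that remain. -/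
noncomputable def potential (s : SearchState n) : ℕ :=
  (s.todo.map fun H => 2 * H.ncard ^ 2 + 1).sum

/-- The separator may miss the current set, so the number of pending vertices need not drop. With a,
s, b the sizes of the three parts, the non-zero denominator gives a + s ≥ 1 and b + s ≥ 1, hence 2a²
+ 2b² + 1 < 2(a + s + b)². The summand 1 pays for discarding a set of weight zero, even an empty
one. -/
theorem potential_step_lt (hout : ProposesCuts out f) (hs : s.todo ≠ []) :
    (s.step out I).potential < s.potential := by
  obtain ⟨H, T, hT⟩ := List.exists_cons_of_ne_nil hs
  have hH : s.current = H := by simp [current, hT]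
  by_cases h : s.Heavy I
  · obtain ⟨A, S, B, h₁, h₂, h₃, h₄, -, h₅, -, h₆, -⟩ := exists_split hout h
    have hne : ∀ X, mass I.w X ≠ 0 → 0 < X.ncard := fun X hX => by
      obtain ⟨v, hv, -⟩ := mass_ne_zero.1 hX
      exact (Set.ncard_pos X.toFinite).2 ⟨v, hv⟩
    have hA := hne _ (left_ne_zero_of_mul h₆)
    have hB := hne _ (right_ne_zero_of_mul h₆)
    rw [Set.ncard_union_eq h₂ A.toFinite S.toFinite] at hA
    rw [Set.ncard_union_eq h₄.symm B.toFinite S.toFinite] at hB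
    have hc : H.ncard = A.ncard + S.ncard + B.ncard := by
      rw [← hH, ← h₁, Set.ncard_union_eq (Set.disjoint_union_left.2 ⟨h₃, h₄⟩) (Set.toFinite _)
        B.toFinite, Set.ncard_union_eq h₂ A.toFinite S.toFinite]
    have key : 2 * A.ncard ^ 2 + 2 * B.ncard ^ 2 + 1 < 2 * H.ncard ^ 2 := by
      rw [hc]
      rcases Nat.eq_zero_or_pos S.ncard with h | h
      · rw [h] at hA hB ⊢
        nlinarith
      · nlinarith [Nat.zero_le (A.ncard * B.ncard)]
    simp only [potential, h₅, hT, List.tail_cons, List.map_cons, List.sum_cons]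
    omega
  · simp [potential, step_todo_of_not_heavy h, hT]

end SearchState

theorem SearchInstance.le_size_encode {n : ℕ} (I : SearchInstance n) : n ≤ I.encode.size := by
  have := length_lt_size_ofList (List.ofFn fun i => ofSet {j | I.G.Adj i j})
  rw [List.length_ofFn] at this
  simp only [encode, ofRel, ofVec, size] at this ⊢
  omega

-- The final state is described only through the properties that steps preserve, so that the cost
-- analysis does not see the loop.
open SearchState in
theorem Computes.decompose {out : (Σ n, SearchInstance n) → Data} {f : ℕ → ℝ}
    (h : Computes (fun I : Σ n, SearchInstance n => I.2.encode) out)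
    (hout : ProposesCuts out f) :
    ∃ fin : (Σ n, SearchInstance n) → (n : ℕ) × SearchInstance n × SearchState n,
      Computes (fun I : Σ n, SearchInstance n => I.2.encode) (fun I => encode (fin I)) ∧
      ∀ (n : ℕ) (I : SearchInstance n) (P : SearchState n → Prop),
        (∀ s, s.todo ≠ [] → P s → P (s.step out I)) → P (.init n) →
        ∃ s, fin ⟨n, I⟩ = ⟨n, I, s⟩ ∧ P s ∧ s.todo = [] := by
  let α := (n : ℕ) × SearchInstance n × SearchState n
  let test : α → Prop := fun a => a.2.2.todo ≠ []
  let step : α → α := fun a => ⟨a.1, a.2.1, a.2.2.step out a.2.1⟩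
  let μ : α → ℕ := fun a => a.2.2.potential
  have hμ : ∀ a, test a → μ (step a) < μ a := fun a ha => potential_step_lt hout ha
  have hlen : ∀ a : α, a.2.2.todo.length ≤ μ a := fun a => by
    have := List.length_le_sum_of_one_le (a.2.2.todo.map fun H => 2 * H.ncard ^ 2 + 1) (by simp)
    rwa [List.length_map] at this
  have main : Computes encode fun a => encode (iterateUntil test step μ hμ a) := by
    have htest : Decides encode test := by
      refine (refl encode).snd.fst.ne_nil.congr fun a => ?_
      cases h : a.2.2.todo <;> simp [test, h, ofList]
    -- The instance is fixed and the potential decreases. The potential bounds the number of pending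
    -- sets, and each set, like the order, has size polynomial in the number of vertices.
    refine while_loop (sz := fun a => a.2.1.encode.size + a.2.2.potential)
      (.X + (.X * (.X * 4 + 2) + 1) + (.X * 4 + 1) + (.X * (.X * 4 + 2) + 1) + 3)
      (.X + .X * (2 * .X ^ 2 + 1)) .X htest (Computes.step h) hμ
      (fun a ha => Nat.add_le_add_left (hμ a ha).le _) ?_ ?_ ?_ (fun _ => iterateUntil_of_not)
      fun _ => iterateUntil_step
    · intro a
      have h₁ := hlen a
      have h₂ := a.2.1.le_size_encode
      have h₃ := size_ofSet_le a.2.2.done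
      have h₄ := size_ofRel_le a.2.2.before
      have h₅ := size_ofList_le (a.2.2.todo.map ofSet) (a.1 * 4 + 1) (by
        intro x hx
        obtain ⟨H, -, rfl⟩ := List.mem_map.1 hx
        exact size_ofSet_le H)
      rw [List.length_map] at h₅
      have e₂ (m : ℕ) : Polynomial.eval m (2 : Polynomial ℕ) = 2 := Polynomial.eval_ofNat _ _
      have e₃ (m : ℕ) : Polynomial.eval m (3 : Polynomial ℕ) = 3 := Polynomial.eval_ofNat _ _
      have e₄ (m : ℕ) : Polynomial.eval m (4 : Polynomial ℕ) = 4 := Polynomial.eval_ofNat _ _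
      simp only [encode, size, Polynomial.eval_add, Polynomial.eval_mul, Polynomial.eval_X,
        Polynomial.eval_one, e₂, e₃, e₄]
      set m := a.2.1.encode.size + a.2.2.potential with hm
      have h₆ : a.1 ≤ m := by omega
      have h₇ : a.2.2.todo.length ≤ m := h₁.trans (by simp [hm, μ])
      have h₈ : a.2.2.todo.length * (a.1 * 4 + 1 + 1) ≤ m * (m * 4 + 2) :=
        Nat.mul_le_mul h₇ (by omega)
      have h₉ : a.1 * (a.1 * 4 + 2) ≤ m * (m * 4 + 2) := by gcongr
      omega
    · intro a
      have h₁ := a.2.1.le_size_encode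
      have h₂ := length_lt_size_ofList (a.2.2.todo.map ofSet)
      rw [List.length_map] at h₂
      have h₃ := List.sum_le_card_nsmul (a.2.2.todo.map fun H => 2 * H.ncard ^ 2 + 1)
        (2 * a.1 ^ 2 + 1) (by
          intro x hx
          obtain ⟨H, -, rfl⟩ := List.mem_map.1 hx
          have : H.ncard ≤ a.1 := by simpa using H.ncard_le_card
          gcongr)
      rw [List.length_map, smul_eq_mul] at h₃
      have e₂ (m : ℕ) : Polynomial.eval m (2 : Polynomial ℕ) = 2 := Polynomial.eval_ofNat _ _
      simp only [Polynomial.eval_add, Polynomial.eval_mul, Polynomial.eval_X, Polynomial.eval_pow,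
        Polynomial.eval_one, e₂]
      have h₄ : a.2.1.encode.size ≤ (encode a).size := by simp only [encode, size]; omega
      have h₅ : a.2.2.todo.length ≤ (encode a).size := by simp only [encode, size]; omega
      refine Nat.add_le_add h₄ (h₃.trans ?_)
      gcongr
      omega
    · intro a
      simp [μ]
  refine ⟨fun I => iterateUntil test step μ hμ ⟨I.1, I.2, .init I.1⟩,
    Computes.init.trans (main.restrict _), fun n I P hP h₀ => ?_⟩
  obtain ⟨⟨s, h₁, h₂⟩, h₃⟩ := iterateUntil_spec (h := hμ) (a := ⟨n, I, .init n⟩)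
    (P := fun a => ∃ s, a = ⟨n, I, s⟩ ∧ P s) (by
      rintro _ ht ⟨s, rfl, hs⟩
      exact ⟨s.step out I, rfl, hP s ht hs⟩) ⟨_, rfl, h₀⟩
  refine ⟨s, h₁, h₂, ?_⟩
  rw [h₁] at h₃
  simpa [test] using h₃

/-! ### Connected sets, and decision trees given by orders -/

/-- A set of vertices that induces a connected (or empty) graph. -/
def ConnectedIn {V : Type} (G : SimpleGraph V) (K : Set V) : Prop :=
  ∀ X ⊆ K, X.Nonempty → (∀ u ∈ X, ∀ v ∈ K, G.Adj u v → v ∈ X) → K ⊆ X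

section

variable {V : Type} {G : SimpleGraph V}

theorem SimpleGraph.Reachable.of_closed {W : Type} {G' : SimpleGraph W} {a b : W}
    (h : G'.Reachable a b) {P : W → Prop} (hP : ∀ u v, G'.Adj u v → P u → P v) (ha : P a) : P b := by
  rw [SimpleGraph.reachable_iff_reflTransGen] at h
  induction h with
  | refl => exact ha
  | tail _ h ih => exact hP _ _ h ih

theorem mem_image_supp {H : Set V} {K : (G.induce H).ConnectedComponent} {x : V} :
    x ∈ Subtype.val '' K.supp ↔ ∃ h : x ∈ H, (G.induce H).connectedComponentMk ⟨x, h⟩ = K := by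
  simp

theorem connectedIn_component {H : Set V} (K : (G.induce H).ConnectedComponent) :
    ConnectedIn G (Subtype.val '' K.supp) := by
  rintro X hXK ⟨x, hx⟩ hX y hy
  obtain ⟨hxH, rfl⟩ := mem_image_supp.1 (hXK hx)
  obtain ⟨hyH, hy⟩ := mem_image_supp.1 hy
  refine (SimpleGraph.ConnectedComponent.exact hy.symm).of_closed (P := fun z => z.1 ∈ X) ?_ hx
  intro u v huv hu
  obtain ⟨h₁, h₂⟩ := mem_image_supp.1 (hXK hu)
  exact hX u hu v (mem_image_supp.2 ⟨v.2, h₂ ▸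
    SimpleGraph.ConnectedComponent.connectedComponentMk_eq_of_adj huv.symm⟩) huv

theorem connectedIn_univ (hG : G.Connected) : ConnectedIn G Set.univ := by
  rintro X - ⟨x, hx⟩ hX y -
  exact (hG.preconnected x y).of_closed (P := (· ∈ X)) (fun u v h hu => hX u hu v trivial h) hx

/-- In any decision tree, the first query that hits a connected set is made for all targets in it. -/
theorem DecisionTree.exists_common_query {H : Set V} (D : DecisionTree G H) {K : Set V}
    (hKH : K ⊆ H) (hK : K.Nonempty) (hc : ConnectedIn G K) :
    ∃ q ∈ K, ∀ x ∈ K, q ∈ D.queries x := by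
  induction D with
  | @query H q hq next ih =>
    by_cases hqK : q ∈ K
    · exact ⟨q, hqK, fun x _ => by simp [DecisionTree.queries]⟩
    · have hK' : K ⊆ H \ {q} := fun x hx => ⟨hKH hx, fun h => hqK (h ▸ hx)⟩
      obtain ⟨x₀, hx₀⟩ := hK
      -- A connected set that avoids the query lies in a single component, so the induction descends
      -- into one child until a query hits `K`.
      set C := (G.induce (H \ {q})).connectedComponentMk ⟨x₀, hK' hx₀⟩
      have hC : K ⊆ Subtype.val '' C.supp := by
        refine (hc (K ∩ Subtype.val '' C.supp) Set.inter_subset_left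
          ⟨x₀, hx₀, mem_image_supp.2 ⟨hK' hx₀, rfl⟩⟩ ?_).trans Set.inter_subset_right
        rintro u ⟨huK, hu⟩ v hv huv
        obtain ⟨h₁, h₂⟩ := mem_image_supp.1 hu
        refine ⟨hv, mem_image_supp.2 ⟨hK' hv, h₂ ▸ ?_⟩⟩
        exact (SimpleGraph.ConnectedComponent.connectedComponentMk_eq_of_adj
          (by simpa using huv.symm))
      obtain ⟨p, hp, h⟩ := ih C hC
      refine ⟨p, hp, fun x hx => ?_⟩
      obtain ⟨h₁, h₂⟩ := mem_image_supp.1 (hC hx)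
      rw [DecisionTree.queries, dif_pos h₁, h₂]
      exact List.mem_cons_of_mem _ (h x hx)

/-- For every order of the vertices there is a decision tree that always queries the first vertex of
the candidate set. -/
theorem DecisionTree.exists_of_order [Finite V] {ρ : V → ℕ} (hρ : ρ.Injective) (H : Set V)
    (hne : H.Nonempty) (hc : ConnectedIn G H) :
    ∃ D : DecisionTree G H, ∀ x ∈ H, (D.queries x).Pairwise (fun u v => ρ u < ρ v) ∧
      ∀ y, y ∈ D.queries x ↔
        y ∈ H ∧ Relation.ReflTransGen (fun u v => G.Adj u v ∧ v ∈ H ∧ ρ y < ρ v) y x := by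
  induction hm : H.ncard using Nat.strong_induction_on generalizing H with
  | _ m ih =>
    obtain ⟨q, hq, hmin⟩ := Set.exists_min_image H ρ H.toFinite hne
    have hlt : ∀ v ∈ H, v ≠ q → ρ q < ρ v := fun v hv hvq =>
      lt_of_le_of_ne (hmin v hv) fun h => hvq (hρ h.symm)
    have hsub : ∀ K : (G.induce (H \ {q})).ConnectedComponent,
        Subtype.val '' K.supp ⊆ H \ {q} := by
      rintro K _ ⟨v, -, rfl⟩
      exact v.2
    choose next hnext using fun K : (G.induce (H \ {q})).ConnectedComponent =>
      ih (Subtype.val '' K.supp).ncard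
        (hm ▸ Set.ncard_lt_ncard ⟨(hsub K).trans Set.sdiff_subset, fun h => (hsub K (h hq)).2 rfl⟩
          H.toFinite) (Subtype.val '' K.supp) (K.nonempty_supp.image _) (connectedIn_component K) rfl
    refine ⟨.query q hq next, fun x hx => ?_⟩
    by_cases hxq : x = q
    · subst hxq
      rw [DecisionTree.queries, dif_neg fun h => h.2 rfl]
      refine ⟨List.pairwise_singleton _ _, fun y => ?_⟩
      rw [List.mem_singleton]
      constructor
      · rintro rfl
        exact ⟨hq, .refl⟩
      · rintro ⟨hy, h⟩
        rcases h.cases_tail with h | ⟨z, -, -, -, h⟩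
        · exact h.symm
        · exact absurd (hmin y hy) (not_le.2 h)
    · have hx' : x ∈ H \ {q} := ⟨hx, hxq⟩
      rw [DecisionTree.queries, dif_pos hx']
      set C := (G.induce (H \ {q})).connectedComponentMk ⟨x, hx'⟩ with hC
      have hxC : x ∈ Subtype.val '' C.supp := mem_image_supp.2 ⟨hx', rfl⟩
      obtain ⟨h₁, h₂⟩ := hnext C x hxC
      refine ⟨List.pairwise_cons.2 ⟨fun z hz => ?_, h₁⟩, fun y => ?_⟩
      · have := hsub C ((h₂ z).1 hz).1
        exact hlt z this.1 this.2
      rw [List.mem_cons, h₂ y]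
      constructor
      · rintro (rfl | ⟨h₃, h₄⟩)
        · refine ⟨hq, ?_⟩
          -- The root reaches all of `H`, because `H` is connected and its other vertices all come
          -- later.
          refine (hc {z | z ∈ H ∧ Relation.ReflTransGen
            (fun u v => G.Adj u v ∧ v ∈ H ∧ ρ y < ρ v) y z} (fun z hz => hz.1) ⟨y, hq, .refl⟩ ?_
            hx).2
          rintro u ⟨-, hu⟩ v hv huv
          refine ⟨hv, ?_⟩
          by_cases h : v = y
          · rw [h]
          · exact hu.tail ⟨huv, hv, hlt v hv h⟩
        · exact ⟨(hsub C h₃).1, Relation.ReflTransGen.mono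
            (fun u v h => ⟨h.1, (hsub C h.2.1).1, h.2.2⟩) _ _ h₄⟩
      · rintro ⟨hy, h⟩
        by_cases hyq : y = q
        · exact Or.inl hyq
        refine Or.inr ?_
        have hy' : y ∈ H \ {q} := ⟨hy, hyq⟩
        set C' := (G.induce (H \ {q})).connectedComponentMk ⟨y, hy'⟩ with hC'
        have hyC : y ∈ Subtype.val '' C'.supp := mem_image_supp.2 ⟨hy', rfl⟩
        -- A path from `y` through later vertices never meets `q`, which precedes `y`; so it stays
        -- in the component of `y`.
        have key : x ∈ Subtype.val '' C'.supp ∧ Relation.ReflTransGen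
            (fun u v => G.Adj u v ∧ v ∈ Subtype.val '' C'.supp ∧ ρ y < ρ v) y x := by
          clear_value C
          clear h₁ h₂ hxC hxq hx hx' hC
          induction h with
          | refl => exact ⟨hyC, .refl⟩
          | @tail u v _ huv ih =>
            obtain ⟨h₃, h₄⟩ := ih
            obtain ⟨h₅, h₆⟩ := mem_image_supp.1 h₃
            have hv : v ∈ H \ {q} := ⟨huv.2.1, fun h => by
              rw [Set.mem_singleton_iff] at h
              have := hlt y hy hyq
              have := huv.2.2
              rw [h] at this
              omega⟩
            have hvC : v ∈ Subtype.val '' C'.supp := mem_image_supp.2 ⟨hv, h₆ ▸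
              SimpleGraph.ConnectedComponent.connectedComponentMk_eq_of_adj
                (by simpa using huv.1.symm)⟩
            exact ⟨hvC, h₄.tail ⟨huv.1, hvC, huv.2.2⟩⟩
        have : C = C' := (mem_image_supp.1 key.1).2
        rw [this]
        exact ⟨hyC, key.2⟩

/-- An increasing list ends with its maximum, so the parent of `x` is the last of its other
ancestors. This is the relation that the program can compute. -/
theorem List.pair_suffix_iff {l : List V} {ρ : V → ℕ}
    (hl : l.Pairwise fun u v => ρ u < ρ v) {x : V} (hx : x ∈ l) (hmax : ∀ z ∈ l, ρ z ≤ ρ x) (y : V) :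
    [y, x] <:+ l ↔ y ∈ l ∧ y ≠ x ∧ ¬ ∃ z, z ∈ l ∧ z ≠ x ∧ ρ y < ρ z := by
  have key : ∀ (l : List V), l.Pairwise (fun u v => ρ u < ρ v) → ∀ x ∈ l,
      (∀ z ∈ l, ρ z ≤ ρ x) → ∃ k, l = k ++ [x] ∧ ∀ z ∈ k, ρ z < ρ x := by
    intro l hl x hx hmax
    obtain ⟨k, k', rfl⟩ := List.append_of_mem hx
    cases k' with
    | nil => exact ⟨k, rfl, fun z hz => (List.pairwise_append.1 hl).2.2 z hz x (by simp)⟩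
    | cons z k' =>
      have h₁ := hmax z (by simp)
      have h₂ := (List.pairwise_cons.1 (List.pairwise_append.1 hl).2.1).1 z (by simp)
      omega
  obtain ⟨k, rfl, hk⟩ := key l hl x hx hmax
  have hmem : ∀ z, (z ∈ k ++ [x] ∧ z ≠ x) ↔ z ∈ k := fun z => by
    constructor
    · simp; tauto
    · intro h
      exact ⟨by simp [h], fun h' => (hk z h).ne (by rw [h'])⟩
  have hsuff : [y, x] <:+ k ++ [x] ↔ ∃ t, k = t ++ [y] := by
    constructor
    · rintro ⟨t, ht⟩
      exact ⟨t, (List.append_inj' (by simpa using ht) rfl : _ ∧ [x] = [x]).1.symm⟩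
    · rintro ⟨t, rfl⟩
      exact ⟨t, by simp⟩
  rw [hsuff]
  have hk' := (List.pairwise_append.1 hl).1
  constructor
  · rintro ⟨t, rfl⟩
    obtain ⟨h₁, h₂⟩ := (hmem y).2 (by simp)
    refine ⟨h₁, h₂, fun ⟨z, h₃, h₄, h₅⟩ => ?_⟩
    rcases List.mem_append.1 ((hmem z).1 ⟨h₃, h₄⟩) with h | h
    · have := (List.pairwise_append.1 hk').2.2 z h y (by simp)
      omega
    · rw [List.mem_singleton.1 h] at h₅
      omega
  · rintro ⟨h₁, h₂, h₃⟩
    obtain ⟨t, h, -⟩ := key k hk' y ((hmem y).1 ⟨h₁, h₂⟩) fun z hz => by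
      by_contra hlt
      exact h₃ ⟨z, ((hmem z).2 hz).1, ((hmem z).2 hz).2, not_le.1 hlt⟩
    exact ⟨t, h⟩

/-- Starting from `y` alone, the set of vertices reached grows by at least one vertex per round
until it is stationary, so `n` rounds suffice. -/
theorem iterate_expand_iff {n : ℕ} (adj lt : Fin n → Fin n → Prop) (y x : Fin n) :
    (expand adj lt)^[n] Eq y x ↔ Relation.ReflTransGen (fun u v => adj u v ∧ lt y v) y x := by
  set T : ℕ → Set (Fin n) := fun k => {x | (expand adj lt)^[k] Eq y x} with hT
  have hsucc : ∀ k x, x ∈ T (k + 1) ↔ x ∈ T k ∨ ∃ z, z ∈ T k ∧ adj z x ∧ lt y x := fun k x => by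
    simp only [hT, Function.iterate_succ_apply']
    rfl
  have hmono : ∀ k, T k ⊆ T (k + 1) := fun k x hx => (hsucc k x).2 (Or.inl hx)
  have hfix : ∀ k, k + 1 ≤ (T k).ncard ∨ T (k + 1) = T k := by
    intro k
    induction k with
    | zero =>
      left
      exact (Set.ncard_pos (Set.toFinite _)).2 ⟨y, rfl⟩
    | succ k ih =>
      by_cases h : T (k + 1) = T k
      · right
        ext x
        rw [hsucc (k + 1), h, ← hsucc, h]
      · rcases ih with ih | ih
        · left
          have := Set.ncard_lt_ncard (lt_of_le_of_ne (hmono k) (Ne.symm h)) (Set.toFinite _)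
          omega
        · exact absurd ih h
  have hn : T (n + 1) = T n := (hfix n).resolve_left fun h => by
    have := (T n).ncard_le_card
    rw [Nat.card_fin] at this
    omega
  constructor
  · have : ∀ k x, x ∈ T k → Relation.ReflTransGen (fun u v => adj u v ∧ lt y v) y x := by
      intro k
      induction k with
      | zero => rintro x rfl; exact .refl
      | succ k ih =>
        intro x hx
        rcases (hsucc k x).1 hx with h | ⟨z, hz, h⟩
        · exact ih x h
        · exact (ih z hz).tail h
    exact this n x
  · intro h
    show x ∈ T n
    induction h with
    | refl =>
      have : ∀ k, y ∈ T k := fun k => by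
        induction k with
        | zero => rfl
        | succ k ih => exact hmono k ih
      exact this n
    | tail _ h ih =>
      rw [← hn]
      exact (hsucc n _).2 (Or.inr ⟨_, ih, h⟩)

end

theorem List.sum_toFinset_le {V : Type} [DecidableEq V] (c : V → ℕ) (l : List V) :
    ∑ v ∈ l.toFinset, c v ≤ (l.map c).sum := by
  induction l with
  | nil => simp
  | cons a l ih =>
    rw [List.toFinset_cons, List.map_cons, List.sum_cons]
    by_cases h : a ∈ l.toFinset
    · rw [Finset.insert_eq_of_mem h]
      omega
    · rw [Finset.sum_insert h]
      omega

/-! ### Balanced cuts and budgets from a decision tree -/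

section

variable {V : Type} [Fintype V] {G : SimpleGraph V} {w : V → ℕ}

/-- The weight of the set of targets for which the decision tree queries `q`. -/
noncomputable def DecisionTree.load {H : Set V} (D : DecisionTree G H) (w : V → ℕ) (q : V) : ℕ :=
  mass w {x | q ∈ D.queries x}

/-- The vertices of load more than `t`. -/
def DecisionTree.heavyPart {H : Set V} (D : DecisionTree G H) (w : V → ℕ) (t : ℕ) : Set V :=
  {q | t < D.load w q}

/-- Some query in `K` is made for every target in `K`, so its load is at least the weight of `K`. -/
theorem DecisionTree.mass_le_of_connectedIn (D : DecisionTree G Set.univ) {t : ℕ} {K : Set V}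
    (hK : ConnectedIn G K) (hd : Disjoint K (D.heavyPart w t)) : mass w K ≤ t := by
  rcases K.eq_empty_or_nonempty with rfl | hne
  · simp [mass_empty]
  · obtain ⟨q, hq, h⟩ := D.exists_common_query (Set.subset_univ K) hne hK
    exact (mass_mono h).trans (not_lt.1 fun h' => Set.disjoint_left.1 hd hq h')

theorem mass_diff_add {H K : Set V} (h : K ⊆ H) : mass w (H \ K) + mass w K = mass w H := by
  rw [← mass_union Set.disjoint_sdiff_left, Set.sdiff_union_of_subset h]

/-- This finds a component of positive weight as a smallest closed set of positive weight: a proper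
closed part or its complement in the set would be smaller and still have positive weight. Positivity
makes the exchange in `exists_balanced_split` a strict improvement. -/
theorem exists_min_closed (U : Set V) (h : mass w U ≠ 0) :
    ∃ K ⊆ U, mass w K ≠ 0 ∧ ConnectedIn G K ∧ ∀ u ∈ K, ∀ v ∈ U, G.Adj u v → v ∈ K := by
  obtain ⟨K, ⟨hKU, hK, hcl⟩, hmin⟩ := Set.exists_min_image
    {K : Set V | K ⊆ U ∧ mass w K ≠ 0 ∧ ∀ u ∈ K, ∀ v ∈ U, G.Adj u v → v ∈ K} Set.ncard
    (Set.toFinite _) ⟨U, subset_rfl, h, fun _ _ v hv _ => hv⟩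
  refine ⟨K, hKU, hK, fun X hX hne hXcl => ?_, hcl⟩
  by_contra hKX
  have hadd := mass_diff_add (w := w) hX
  by_cases h0 : mass w X = 0
  · have hlt : (K \ X).ncard < K.ncard := by
      refine Set.ncard_lt_ncard ⟨Set.sdiff_subset, fun h => ?_⟩ K.toFinite
      obtain ⟨x, hx⟩ := hne
      exact (h (hX hx)).2 hx
    refine absurd (hmin (K \ X) ⟨Set.sdiff_subset.trans hKU, by omega, ?_⟩) (not_le.2 hlt)
    rintro u ⟨hu, huX⟩ v hv huv
    exact ⟨hcl u hu v hv huv, fun hvX => huX (hXcl v hvX u hu huv.symm)⟩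
  · have hlt : X.ncard < K.ncard := Set.ncard_lt_ncard ⟨hX, hKX⟩ K.toFinite
    refine absurd (hmin X ⟨hX.trans hKU, h0, ?_⟩) (not_le.2 hlt)
    exact fun u hu v hv huv => hXcl u hu v (hcl u (hX hu) v hv huv) huv

/-- If connected parts of `U` weigh at most half of `r`, then `U` splits into two sets without edges
between them that weigh at most three quarters of `r`. -/
theorem exists_balanced_split {U : Set V} {r : ℕ} (hU : mass w U ≤ r)
    (hK : ∀ K ⊆ U, ConnectedIn G K → 2 * mass w K ≤ r) :
    ∃ A ⊆ U, (∀ u ∈ A, ∀ v ∈ U \ A, ¬ G.Adj u v) ∧ 4 * mass w A ≤ 3 * r ∧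
      4 * mass w (U \ A) ≤ 3 * r := by
  obtain ⟨A, ⟨hAU, hA, hcl⟩, hmax⟩ := Set.exists_max_image
    {A : Set V | A ⊆ U ∧ 4 * mass w A ≤ 3 * r ∧ ∀ u ∈ A, ∀ v ∈ U \ A, ¬ G.Adj u v} (mass w)
    (Set.toFinite _) ⟨∅, Set.empty_subset _, by simp [mass_empty], by simp⟩
  refine ⟨A, hAU, hcl, hA, not_lt.1 fun hlt => ?_⟩
  -- The heaviest admissible `A` weighs less than r/4 if the rest weighs more than 3r/4. Adding a
  -- component of the rest, of weight at most r/2, would then stay admissible and be heavier.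
  obtain ⟨K, hKU, hK0, hKc, hKcl⟩ := exists_min_closed (G := G) (w := w) (U \ A) (by omega)
  have h₁ := hK K (hKU.trans Set.sdiff_subset) hKc
  have h₂ := mass_diff_add (w := w) hAU
  have h₃ : mass w (A ∪ K) = mass w A + mass w K :=
    mass_union (Set.disjoint_right.2 fun x hx => (hKU hx).2)
  have := hmax (A ∪ K) ⟨Set.union_subset hAU (hKU.trans Set.sdiff_subset), by omega, ?_⟩
  · omega
  · rintro u (hu | hu) v ⟨hv, hvAK⟩ huv
    · exact hcl u hu v ⟨hv, fun h => hvAK (Or.inl h)⟩ huv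
    · exact hvAK (Or.inr (hKcl u hu v ⟨hv, fun h => hvAK (Or.inl h)⟩ huv))

/-- A set `H` of weight `r` has a balanced vertex cut along the vertices of load more than `r / 2`. -/
theorem DecisionTree.exists_vertexCut [DecidableEq V] (D : DecisionTree G Set.univ)
    (c w : V → ℕ) (H : Set V) :
    ∃ X : VertexCut G, 3 * mass w H ^ 2 ≤ 16 * X.denom (H.indicator w) ∧
      ∑ v ∈ X.S, H.indicator c v = mass c (D.heavyPart w (mass w H / 2) ∩ H) := by
  classical
  set r := mass w H with hr
  set L := D.heavyPart w (r / 2) with hL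
  obtain ⟨A, hAU, hcl, hA, hB⟩ := exists_balanced_split (G := G) (w := w) (U := H \ L) (r := r)
    (mass_mono Set.sdiff_subset) fun K hK hKc => by
      have := D.mass_le_of_connectedIn (w := w) (t := r / 2) hKc
        (Set.disjoint_left.2 fun x hx => (hK hx).2)
      omega
  let X : VertexCut G :=
    { A := A.toFinset
      -- Vertices outside `H` have cost and weight zero here, so they can join the separator for
      -- free.
      S := (L ∩ H ∪ Hᶜ).toFinset
      B := ((H \ L) \ A).toFinset
      disjoint_A_S := by
        rw [Set.disjoint_toFinset]
        refine Set.disjoint_left.2 fun x hx => ?_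
        have := hAU hx
        rintro (h | h)
        · exact this.2 h.1
        · exact h this.1
      disjoint_A_B := by
        rw [Set.disjoint_toFinset]
        exact Set.disjoint_left.2 fun x hx h => h.2 hx
      disjoint_S_B := by
        rw [Set.disjoint_toFinset]
        refine Set.disjoint_left.2 fun x hx h => ?_
        rcases hx with hx | hx
        · exact h.1.2 hx.1
        · exact hx h.1.1
      cover := by
        ext x
        simp only [Finset.mem_union, Set.mem_toFinset, Set.mem_union, Set.mem_inter_iff,
          Set.mem_compl_iff, Set.mem_sdiff, Finset.mem_univ, iff_true]
        tauto
      not_adj := fun u hu v hv => hcl u (by simpa using hu) v (by simpa using hv) }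
  have hS : H ∩ (L ∩ H ∪ Hᶜ) = L ∩ H := by
    ext x
    simp only [Set.mem_union, Set.mem_inter_iff, Set.mem_compl_iff]
    tauto
  have h₁ := mass_diff_add (w := w) (Set.inter_subset_right : L ∩ H ⊆ H)
  have h₂ : H \ (L ∩ H) = H \ L := by
    ext x
    simp only [Set.mem_sdiff, Set.mem_inter_iff]
    tauto
  have h₃ := mass_diff_add (w := w) hAU
  rw [h₂] at h₁
  have hd₁ : Disjoint A (L ∩ H) := Set.disjoint_left.2 fun x hx h => (hAU hx).2 h.1
  have hd₂ : Disjoint ((H \ L) \ A) (L ∩ H) := Set.disjoint_left.2 fun x hx h => hx.1.2 h.1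
  have hA' : H ∩ A = A := Set.inter_eq_right.2 (hAU.trans Set.sdiff_subset)
  have hB' : H ∩ ((H \ L) \ A) = (H \ L) \ A :=
    Set.inter_eq_right.2 (Set.sdiff_subset.trans Set.sdiff_subset)
  refine ⟨X, ?_, ?_⟩
  · have hd : X.denom (H.indicator w) =
        (mass w A + mass w (L ∩ H)) * (mass w ((H \ L) \ A) + mass w (L ∩ H)) := by
      rw [VertexCut.denom, sum_indicator_eq_mass, sum_indicator_eq_mass, ← mass_union hd₁,
        ← mass_union hd₂]
      simp only [X, Finset.coe_union, Set.coe_toFinset, Set.inter_union_distrib_left (s := H),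
        hA', hB']
      rw [← Set.inter_union_distrib_left, hS]
    rw [hd]
    have e₁ : r ≤ 4 * (mass w A + mass w (L ∩ H)) := by omega
    have e₂ : r ≤ 4 * (mass w ((H \ L) \ A) + mass w (L ∩ H)) := by omega
    have e₃ : r ≤ (mass w A + mass w (L ∩ H)) + (mass w ((H \ L) \ A) + mass w (L ∩ H)) := by omega
    generalize mass w A + mass w (L ∩ H) = x at e₁ e₃ ⊢
    generalize mass w ((H \ L) \ A) + mass w (L ∩ H) = y at e₂ e₃ ⊢
    zify at *
    -- From (4x - r)(4y - r) ≥ 0 and x + y ≥ r follows 16xy ≥ 3r².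
    nlinarith [mul_nonneg (sub_nonneg.2 e₁) (sub_nonneg.2 e₂),
      mul_nonneg (Int.natCast_nonneg r) (sub_nonneg.2 e₃)]
  · rw [sum_indicator_eq_mass]
    simp only [X, Set.coe_toFinset, hS]

/-- The share of the cost of `D`, up to a factor, that is available to search the set `H`. -/
noncomputable def DecisionTree.budget (D : DecisionTree G Set.univ) (c w : V → ℕ) (H : Set V) : ℕ :=
  ∑ t ∈ Finset.range (mass w H), mass c (D.heavyPart w ((t + 1) / 2) ∩ H)

theorem DecisionTree.heavyPart_anti (D : DecisionTree G Set.univ) {s t : ℕ} (h : s ≤ t) :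
    D.heavyPart w t ⊆ D.heavyPart w s :=
  fun _ hq => lt_of_le_of_lt h hq

/-- For t < w(B) the layers of `A` and `B` are disjoint parts of the layer of `H`. For w(B) ≤ t <
w(H) one has (t+1)/2 ≤ w(H)/2, so the layer of `H` contains the heavy vertices along which `H` has a
balanced cut; these layers are released. -/
theorem DecisionTree.budget_split (D : DecisionTree G Set.univ) (c w : V → ℕ) {H A B : Set V}
    (hA : A ⊆ H) (hB : B ⊆ H) (hd : Disjoint A B) (hle : mass w A ≤ mass w B) :
    D.budget c w A + D.budget c w B +
      (mass w H - mass w B) * mass c (D.heavyPart w (mass w H / 2) ∩ H) ≤ D.budget c w H := by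
  have hBH : mass w B ≤ mass w H := mass_mono hB
  have h₁ : D.budget c w A ≤
      ∑ t ∈ Finset.range (mass w B), mass c (D.heavyPart w ((t + 1) / 2) ∩ A) :=
    Finset.sum_le_sum_of_subset (Finset.range_subset_range.2 hle)
  have h₂ : D.budget c w A + D.budget c w B ≤
      ∑ t ∈ Finset.range (mass w B), mass c (D.heavyPart w ((t + 1) / 2) ∩ H) := by
    refine (Nat.add_le_add_right h₁ _).trans ?_
    rw [budget, ← Finset.sum_add_distrib]
    refine Finset.sum_le_sum fun t _ => ?_
    rw [← mass_union (hd.mono Set.inter_subset_right Set.inter_subset_right)]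
    exact mass_mono (Set.union_subset (Set.inter_subset_inter_right _ hA)
      (Set.inter_subset_inter_right _ hB))
  have h₃ : (mass w H - mass w B) * mass c (D.heavyPart w (mass w H / 2) ∩ H) ≤
      ∑ t ∈ Finset.Ico (mass w B) (mass w H), mass c (D.heavyPart w ((t + 1) / 2) ∩ H) := by
    rw [← Nat.card_Ico, ← smul_eq_mul]
    refine Finset.card_nsmul_le_sum _ _ _ fun t ht => ?_
    rw [Finset.mem_Ico] at ht
    exact mass_mono (Set.inter_subset_inter_left _ (D.heavyPart_anti (by omega)))
  calc _ ≤ _ := Nat.add_le_add h₂ h₃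
    _ = D.budget c w H := by
      rw [budget, Finset.range_eq_Ico, Finset.range_eq_Ico,
        Finset.sum_Ico_consecutive _ (Nat.zero_le _) hBH]

open Classical in
theorem mass_eq_sum_ite (w : V → ℕ) (H : Set V) : mass w H = ∑ v, if v ∈ H then w v else 0 := by
  simp [mass, Set.indicator_apply]

/-- A vertex lies in layer t only if t is less than twice its load, and summing cost times load over
the vertices counts the queries of every target. -/
theorem DecisionTree.budget_univ_le (D : DecisionTree G Set.univ) (c w : V → ℕ) :
    D.budget c w Set.univ ≤ 2 * D.cost c w := by
  classical
  calc D.budget c w Set.univ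
      = ∑ q, ∑ t ∈ Finset.range (mass w Set.univ), if (t + 1) / 2 < D.load w q then c q else 0 := by
        rw [Finset.sum_comm]
        refine Finset.sum_congr rfl fun t _ => ?_
        rw [Set.inter_univ, mass_eq_sum_ite]
        exact Finset.sum_congr rfl fun q _ => if_congr Iff.rfl rfl rfl
    _ ≤ ∑ q, 2 * (D.load w q * c q) := by
        refine Finset.sum_le_sum fun q _ => ?_
        rw [← Finset.sum_filter, Finset.sum_const, smul_eq_mul, ← mul_assoc]
        refine Nat.mul_le_mul_right _ ?_
        refine (Finset.card_le_card (t := Finset.range (2 * D.load w q)) fun t ht => ?_).trans_eq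
          (Finset.card_range _)
        have := (Finset.mem_filter.1 ht).2
        rw [Finset.mem_range]
        omega
    _ = 2 * ∑ x, w x * ∑ q ∈ (D.queries x).toFinset, c q := by
        rw [← Finset.mul_sum]
        congr 1
        simp only [DecisionTree.load, mass_eq_sum_ite, Finset.sum_mul, Finset.mul_sum]
        rw [Finset.sum_comm]
        refine Finset.sum_congr rfl fun x _ => ?_
        rw [← Finset.sum_subset (Finset.subset_univ (D.queries x).toFinset)]
        · refine Finset.sum_congr rfl fun q hq => ?_
          rw [List.mem_toFinset] at hq
          simp [hq]
        · intro q _ hq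
          rw [List.mem_toFinset] at hq
          simp [hq]
    -- An inequality is enough, so query lists need not be known to be free of repetitions.
    _ ≤ 2 * D.cost c w := by
        rw [cost]
        gcongr with x
        exact List.sum_toFinset_le c _

end

/-- With unit costs and weights on the same connected graph, every cut of non-zero denominator has a
non-empty separator. The minimum ratio is then positive, which excludes a negative factor. -/
theorem ProposesCuts.nonneg {out : (Σ n, SearchInstance n) → Data} {f : ℕ → ℝ}
    (hout : ProposesCuts out f) {n : ℕ} (I : SearchInstance n) : 0 ≤ f n := by
  have hn : 0 < n := Fin.pos_iff_nonempty.2 I.connected.nonempty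
  let J : SearchInstance n := { I with c := 1, w := 1 }
  obtain ⟨X, -, hX, hle⟩ := hout n J (by simp [J]; omega)
  have hpos : ∀ Y : VertexCut J.G, Y.denom J.w ≠ 0 → 1 / ((n * n : ℕ) : ℝ) ≤ Y.ratio J.c J.w := by
    intro Y hY
    have hle : ∀ F : Finset (Fin n), ∑ v ∈ F, J.w v ≤ n := fun F => by
      simpa [J] using F.card_le_univ
    have hS : Y.S.Nonempty := by
      rw [Finset.nonempty_iff_ne_empty]
      intro hS
      have hA : Y.A.Nonempty := by
        rw [Finset.nonempty_iff_ne_empty]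
        intro hA
        exact hY (by simp [VertexCut.denom, hA, hS])
      have hB : Y.B.Nonempty := by
        rw [Finset.nonempty_iff_ne_empty]
        intro hB
        exact hY (by simp [VertexCut.denom, hB, hS])
      obtain ⟨b, hb⟩ := hB
      refine Finset.disjoint_right.1 Y.disjoint_A_B hb ?_
      refine connectedIn_univ J.connected (Y.A : Set (Fin n)) (Set.subset_univ _) hA ?_ trivial
      intro u hu v _ huv
      have := Y.cover ▸ Finset.mem_univ v
      rw [hS, Finset.union_empty, Finset.mem_union] at this
      exact this.resolve_right fun h => Y.not_adj u hu v h huv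
    have hS' : 1 ≤ ∑ v ∈ Y.S, J.c v := by
      simpa [J] using Finset.card_pos.2 hS
    have hd : Y.denom J.w ≤ n * n := Nat.mul_le_mul (hle _) (hle _)
    rw [VertexCut.ratio]
    have h₁ : (0 : ℝ) < Y.denom J.w := by exact_mod_cast Nat.pos_of_ne_zero hY
    gcongr
    exact_mod_cast hS'
  have hmin : 1 / ((n * n : ℕ) : ℝ) ≤ J.minRatio := by
    refine le_csInf ⟨_, X, hX, rfl⟩ ?_
    rintro _ ⟨Y, hY, rfl⟩
    exact hpos Y hY
  have h₀ : (0 : ℝ) < 1 / ((n * n : ℕ) : ℝ) := by positivity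
  by_contra hf
  have := mul_neg_of_neg_of_pos (not_le.1 hf) (h₀.trans_le hmin)
  linarith [hpos X hX]

/-! ### The budget pays for a cut -/

namespace SearchInstance

variable {n : ℕ} (I : SearchInstance n)

theorem minRatio_restrict_le (D : DecisionTree I.G Set.univ) {H : Set (Fin n)}
    (hH : mass I.w H ≠ 0) :
    (I.restrict H).minRatio ≤
      16 * mass I.c (D.heavyPart I.w (mass I.w H / 2) ∩ H) / (3 * (mass I.w H : ℝ) ^ 2) := by
  obtain ⟨X, h₁, h₂⟩ := D.exists_vertexCut I.c I.w H
  have hpos : 0 < mass I.w H := Nat.pos_of_ne_zero hH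
  have hd : 0 < X.denom (H.indicator I.w) := by
    have : 0 < 3 * mass I.w H ^ 2 := by positivity
    omega
  have h₃ : (I.restrict H).minRatio ≤ X.ratio (H.indicator I.c) (H.indicator I.w) := by
    refine csInf_le ⟨0, ?_⟩ ⟨X, hd.ne', rfl⟩
    rintro _ ⟨Y, -, rfl⟩
    rw [VertexCut.ratio]
    positivity
  refine h₃.trans ?_
  rw [VertexCut.ratio, h₂]
  have h₄ : (3 : ℝ) * (mass I.w H : ℝ) ^ 2 ≤ 16 * X.denom (H.indicator I.w) := by exact_mod_cast h₁
  have h₅ : (0 : ℝ) < X.denom (H.indicator I.w) := by exact_mod_cast hd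
  have h₆ : (0 : ℝ) < mass I.w H := by exact_mod_cast hpos
  rw [div_le_div_iff₀ h₅ (by positivity)]
  have := mul_le_mul_of_nonneg_left h₄
    (Nat.cast_nonneg (α := ℝ) (mass I.c (D.heavyPart I.w (mass I.w H / 2) ∩ H)))
  linarith

/-- A vertex cut of small ratio is paid by the budget that it releases. -/
theorem cost_split_le (D : DecisionTree I.G Set.univ) {κ : ℝ} (hκ : 0 ≤ κ) {H A S B : Set (Fin n)}
    (hU : A ∪ S ∪ B = H) (hAS : Disjoint A S) (hAB : Disjoint A B) (hSB : Disjoint S B)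
    (hd : mass I.w (A ∪ S) * mass I.w (B ∪ S) ≠ 0)
    (hr : (mass I.c S : ℝ) / (mass I.w (A ∪ S) * mass I.w (B ∪ S) : ℕ) ≤
      κ * (I.restrict H).minRatio) (hle : mass I.w A ≤ mass I.w B) :
    (mass I.c S * mass I.w H : ℝ) + 16 / 3 * κ * (D.budget I.c I.w A + D.budget I.c I.w B) ≤
      16 / 3 * κ * D.budget I.c I.w H := by
  have hA : A ⊆ H := hU ▸ Set.subset_union_left.trans Set.subset_union_left
  have hB : B ⊆ H := hU ▸ Set.subset_union_right
  have hm : mass I.w H = mass I.w A + mass I.w S + mass I.w B := by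
    rw [← hU, mass_union (Set.disjoint_union_left.2 ⟨hAB, hSB⟩), mass_union hAS]
  have h₁ := D.budget_split I.c I.w hA hB hAB hle
  rw [mass_union hAS, mass_union hSB.symm] at hd hr
  have hpos : mass I.w H ≠ 0 := fun h => by
    refine hd ?_
    rw [show mass I.w A + mass I.w S = 0 by omega, zero_mul]
  have h₂ := hr.trans (mul_le_mul_of_nonneg_left (I.minRatio_restrict_le D hpos) hκ)
  set l := mass I.c (D.heavyPart I.w (mass I.w H / 2) ∩ H) with hl
  have h₃ : D.budget I.c I.w A + D.budget I.c I.w B + (mass I.w A + mass I.w S) * l ≤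
      D.budget I.c I.w H := by
    rwa [show mass I.w H - mass I.w B = mass I.w A + mass I.w S by omega] at h₁
  have hx : (0 : ℝ) < mass I.w A + mass I.w S := by
    exact_mod_cast Nat.pos_of_ne_zero (left_ne_zero_of_mul hd)
  have hy : (0 : ℝ) < mass I.w B + mass I.w S := by
    exact_mod_cast Nat.pos_of_ne_zero (right_ne_zero_of_mul hd)
  have hy' : (mass I.w B + mass I.w S : ℝ) ≤ mass I.w H := by
    rw [hm]
    push_cast
    linarith [Nat.cast_nonneg (α := ℝ) (mass I.w A)]
  have hr' : (0 : ℝ) < mass I.w H := by exact_mod_cast Nat.pos_of_ne_zero hpos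
  have h₃' : (D.budget I.c I.w A + D.budget I.c I.w B + (mass I.w A + mass I.w S) * l : ℝ) ≤
      D.budget I.c I.w H := by exact_mod_cast h₃
  push_cast at h₂
  set x : ℝ := (mass I.w A + mass I.w S : ℝ)
  set y : ℝ := (mass I.w B + mass I.w S : ℝ)
  set r : ℝ := (mass I.w H : ℝ)
  -- Since `y ≤ r`, one factor of r² absorbs `y` and the other moves to the left. As `x` is w(H) -
  -- w(B), the amount `x * l` is exactly what `DecisionTree.budget_split` releases.
  have h₄ : (mass I.c S : ℝ) * r ≤ 16 / 3 * κ * (x * l) := by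
    rw [div_le_iff₀ (by positivity)] at h₂
    have h₅ : κ * (16 * l / (3 * r ^ 2)) * (x * y) ≤ κ * (16 * l / (3 * r ^ 2)) * (x * r) := by
      gcongr
    have h₆ : κ * (16 * l / (3 * r ^ 2)) * (x * r) = 16 / 3 * κ * (x * l) / r := by
      field_simp
    rw [h₆] at h₅
    exact (le_div_iff₀ hr').1 (h₂.trans h₅)
  have h₇ := mul_le_mul_of_nonneg_left h₃' (by positivity : 0 ≤ 16 / 3 * κ)
  linarith

end SearchInstance

/-! ### The invariant of the decomposition and the resulting tree -/

namespace SearchState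

variable {n : ℕ}

/-- The vertices in `done` are ordered by `ρ`, and `node y` contains every target for which `y` is
queried; the total cost of these queries is paid by the released budget. -/
structure Invariant (I : SearchInstance n) (D : DecisionTree I.G Set.univ) (κ : ℝ)
    (s : SearchState n) (ρ : Fin n → ℕ) (N : ℕ) (node : Fin n → Set (Fin n)) : Prop where
  inj : Set.InjOn ρ s.done
  lt : ∀ v ∈ s.done, ρ v < N
  before_iff : ∀ u v, s.before u v ↔ u ∈ s.done ∧ (v ∈ s.done → ρ u < ρ v)
  mem_node : ∀ y ∈ s.done, y ∈ node y
  node_closed : ∀ y ∈ s.done, ∀ u ∈ node y, ∀ v ∉ node y, I.G.Adj u v → v ∈ s.done ∧ ρ v < ρ y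
  disjoint_done : ∀ T ∈ s.todo, Disjoint T s.done
  todo_closed : ∀ T ∈ s.todo, ∀ u ∈ T, ∀ v ∉ T, I.G.Adj u v → v ∈ s.done
  disjoint : s.todo.Pairwise Disjoint
  cover : ∀ v ∉ s.done, ∃ T ∈ s.todo, v ∈ T
  cost_le : (mass (fun y => I.c y * mass I.w (node y)) s.done : ℝ) +
    16 / 3 * κ * ((s.todo.map (D.budget I.c I.w)).sum : ℕ) ≤
      16 / 3 * κ * D.budget I.c I.w Set.univ

variable {I : SearchInstance n} {D : DecisionTree I.G Set.univ} {κ : ℝ} {s : SearchState n}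
  {ρ : Fin n → ℕ} {N : ℕ} {node : Fin n → Set (Fin n)}

theorem Invariant.init (I : SearchInstance n) (D : DecisionTree I.G Set.univ) (κ : ℝ) :
    Invariant I D κ (.init n) (fun _ => 0) 0 fun _ => ∅ := by
  constructor <;> simp [SearchState.init, mass_empty]

-- This covers both kinds of step: `T'` consists of the two sides of a cut, or is empty with `S = H`
-- for weight zero. New vertices get the positions `N + v`, after all earlier ones and by index
-- among themselves.
open Classical in
theorem Invariant.extend (h : Invariant I D κ s ρ N node) {H S : Set (Fin n)}
    {T T' : List (Set (Fin n))} (hs : s.todo = H :: T) (hS : S ⊆ H) (hT' : ∀ X ∈ T', X ⊆ H \ S)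
    (hd : T'.Pairwise Disjoint) (hcov : ∀ v ∈ H, v ∉ S → ∃ X ∈ T', v ∈ X)
    (hcl : ∀ X ∈ T', ∀ u ∈ X, ∀ v ∈ H, v ∉ X → I.G.Adj u v → v ∈ S)
    (hcost : (mass I.c S * mass I.w H : ℝ) + 16 / 3 * κ * ((T'.map (D.budget I.c I.w)).sum : ℕ) ≤
      16 / 3 * κ * D.budget I.c I.w H) :
    Invariant I D κ
      { todo := T' ++ T
        done := {v | v ∈ s.done ∨ v ∈ S}
        before := fun u v => s.before u v ∨ (u ∈ S ∧ v ∉ s.done ∧ (v ∈ S → u < v)) }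
      (fun v => if v ∈ s.done then ρ v else N + v) (N + n)
      (fun v => if v ∈ s.done then node v else H) := by
  have hHd := h.disjoint_done H (by simp [hs])
  have hHcl := h.todo_closed H (by simp [hs])
  have hpw := h.disjoint
  rw [hs, List.pairwise_cons] at hpw
  have hSd : ∀ v ∈ S, v ∉ s.done := fun v hv => Set.disjoint_left.1 hHd (hS hv)
  have hTm : ∀ X ∈ T, X ∈ s.todo := fun X hX => by simp [hs, hX]
  constructor
  · rintro u hu v hv huv
    dsimp only at huv
    by_cases hu' : u ∈ s.done <;> by_cases hv' : v ∈ s.done <;> simp only [hu', hv', if_true,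
      if_false] at huv
    · exact h.inj hu' hv' huv
    · have := h.lt u hu'
      omega
    · have := h.lt v hv'
      omega
    · exact Fin.ext (by omega)
  · intro v _
    have := v.2
    by_cases hv : v ∈ s.done
    · have := h.lt v hv
      simp only [hv, if_true]
      omega
    · simp only [hv, if_false]
      omega
  · intro u v
    dsimp only
    rw [h.before_iff]
    simp only [Set.mem_ofPred_eq]
    by_cases hu : u ∈ s.done <;> by_cases hv : v ∈ s.done
    · have := fun h' => hSd u h' hu
      simp [hu, hv]
    · have h₁ := h.lt u hu
      simp [hu, hv]
      omega
    · have h₁ := h.lt v hv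
      simp [hu, hv]
      omega
    · simp [hu, hv]
  · rintro y (hy | hy)
    · simpa [hy] using h.mem_node y hy
    · simpa [hSd y hy] using hS hy
  · rintro y (hy | hy) u hu v hv huv
    · simp only [hy, if_true] at hu hv ⊢
      have := h.node_closed y hy u hu v hv huv
      exact ⟨Or.inl this.1, by simpa [this.1] using this.2⟩
    · simp only [hSd y hy, if_false] at hu hv ⊢
      have h₁ := hHcl u hu v hv huv
      have h₂ := h.lt v h₁
      refine ⟨Or.inl h₁, ?_⟩
      simp only [h₁, if_true]
      omega
  · intro X hX
    rw [Set.disjoint_left]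
    rcases List.mem_append.1 hX with hX | hX
    · rintro v hv (hv' | hv')
      · exact Set.disjoint_left.1 hHd (hT' X hX hv).1 hv'
      · exact (hT' X hX hv).2 hv'
    · rintro v hv (hv' | hv')
      · exact Set.disjoint_left.1 (h.disjoint_done X (hTm X hX)) hv hv'
      · exact Set.disjoint_left.1 (hpw.1 X hX) (hS hv') hv
  · intro X hX u hu v hv huv
    rcases List.mem_append.1 hX with hX | hX
    · by_cases hvH : v ∈ H
      · exact Or.inr (hcl X hX u hu v hvH hv huv)
      · exact Or.inl (hHcl u (hT' X hX hu).1 v hvH huv)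
    · exact Or.inl (h.todo_closed X (hTm X hX) u hu v hv huv)
  · refine List.pairwise_append.2 ⟨hd, hpw.2, fun X hX Y hY => ?_⟩
    exact (hpw.1 Y hY).mono_left ((hT' X hX).trans Set.sdiff_subset)
  · intro v hv
    simp only [Set.mem_ofPred_eq, not_or] at hv
    obtain ⟨X, hX, hvX⟩ := h.cover v hv.1
    rw [hs, List.mem_cons] at hX
    rcases hX with rfl | hX
    · obtain ⟨Y, hY, hvY⟩ := hcov v hvX hv.2
      exact ⟨Y, by simp [hY], hvY⟩
    · exact ⟨X, by simp [hX], hvX⟩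
  · have h₁ := h.cost_le
    have h₂ : mass (fun y => I.c y * mass I.w (if y ∈ s.done then node y else H))
        {v | v ∈ s.done ∨ v ∈ S} =
        mass (fun y => I.c y * mass I.w (node y)) s.done + mass I.c S * mass I.w H := by
      rw [mass_eq_sum_ite I.c, mass_eq_sum_ite _ s.done, mass_eq_sum_ite _ {v | v ∈ s.done ∨ v ∈ S},
        Finset.sum_mul, ← Finset.sum_add_distrib]
      refine Finset.sum_congr rfl fun y _ => ?_
      by_cases hy : y ∈ s.done
      · have : y ∉ S := fun h' => hSd y h' hy
        simp [hy, this]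
      · by_cases hy' : y ∈ S <;> simp [hy, hy']
    dsimp only
    rw [h₂]
    rw [hs, List.map_cons, List.sum_cons] at h₁
    rw [List.map_append, List.sum_append]
    push_cast at h₁ hcost ⊢
    linarith

theorem Invariant.exists_step {out : (Σ n, SearchInstance n) → Data} {f : ℕ → ℝ}
    (hout : ProposesCuts out f) (h : Invariant I D (f n) s ρ N node) (hs : s.todo ≠ []) :
    ∃ ρ' N' node', Invariant I D (f n) (s.step out I) ρ' N' node' := by
  have hκ := hout.nonneg I
  obtain ⟨H, T, hT⟩ := List.exists_cons_of_ne_nil hs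
  have hH : s.current = H := by simp [current, hT]
  have hstep : s.step out I =
      { todo := (s.step out I).todo
        done := {v | v ∈ s.done ∨ v ∈ s.emitted I (out ⟨n, I.restrict s.current⟩)}
        before := fun u v => s.before u v ∨ (u ∈ s.emitted I (out ⟨n, I.restrict s.current⟩) ∧
          v ∉ s.done ∧ (v ∈ s.emitted I (out ⟨n, I.restrict s.current⟩) → u < v)) } := rfl
  rw [hstep]
  by_cases hh : s.Heavy I
  · obtain ⟨A, S, B, h₁, h₂, h₃, h₄, h₅, h₆, h₇, h₈, h₉⟩ := exists_split hout hh
    rw [h₆, h₇, hT, List.tail_cons]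
    rw [hH] at h₁ h₉
    have hmem : ∀ v, v ∈ H ↔ (v ∈ A ∨ v ∈ S) ∨ v ∈ B := fun v => by rw [← h₁]; rfl
    refine ⟨_, _, _, h.extend (T' := [A, B]) hT (fun v hv => (hmem v).2 (Or.inl (Or.inr hv)))
      ?_ (by simpa using h₃) ?_ ?_ ?_⟩
    · simp only [List.mem_cons, List.not_mem_nil, or_false]
      rintro X (rfl | rfl) v hv
      · exact ⟨(hmem v).2 (Or.inl (Or.inl hv)), Set.disjoint_left.1 h₂ hv⟩
      · exact ⟨(hmem v).2 (Or.inr hv), Set.disjoint_right.1 h₄ hv⟩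
    · intro v hv hvS
      have := (hmem v).1 hv
      simp only [List.mem_cons, List.not_mem_nil, or_false, exists_eq_or_imp, exists_eq_left]
      tauto
    · simp only [List.mem_cons, List.not_mem_nil, or_false]
      rintro X (rfl | rfl) u hu v hv hvX huv
      · have := h₅ u hu v
        have := (hmem v).1 hv
        tauto
      · have := fun h' => h₅ v h' u hu huv.symm
        have := (hmem v).1 hv
        tauto
    · simp only [List.map_cons, List.map_nil, List.sum_cons, List.sum_nil, add_zero, Nat.cast_add]
      rcases le_total (mass I.w A) (mass I.w B) with hle | hle
      · exact I.cost_split_le D hκ h₁ h₂ h₃ h₄ h₈ h₉ hle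
      · rw [add_comm (D.budget I.c I.w A : ℝ)]
        rw [mul_comm] at h₈ h₉
        refine I.cost_split_le D hκ ?_ h₄.symm h₃.symm h₂.symm h₈ h₉ hle
        rw [← h₁, Set.union_comm B S, Set.union_comm _ A, Set.union_assoc]
  · rw [step_todo_of_not_heavy hh, emitted_of_not_heavy hh, hH, hT, List.tail_cons]
    rw [heavy_iff, hH, not_not] at hh
    refine ⟨_, _, _, h.extend (T' := []) hT subset_rfl (by simp) (by simp)
      (fun v h₁ h₂ => absurd h₁ h₂) (by simp) ?_⟩
    rw [hh]
    simp only [Nat.cast_zero, mul_zero, List.map_nil, List.sum_nil, add_zero]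
    positivity

/-- The order of a final state gives a decision tree of small cost. -/
theorem Invariant.exists_decisionTree (h : Invariant I D κ s ρ N node) (hs : s.todo = []) :
    ∃ D' : DecisionTree I.G Set.univ,
      D'.encode = ofRel (lastBefore s.before ((expand I.G.Adj s.before)^[n] Eq)) ∧
      (D'.cost I.c I.w : ℝ) ≤ 16 / 3 * κ * D.budget I.c I.w Set.univ := by
  classical
  have hdone : ∀ v, v ∈ s.done := fun v => by
    by_contra hv
    obtain ⟨X, hX, -⟩ := h.cover v hv
    simp [hs] at hX
  have hρ : ρ.Injective := fun u v huv => h.inj (hdone u) (hdone v) huv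
  have hbefore : ∀ u v, s.before u v ↔ ρ u < ρ v := fun u v => by
    rw [h.before_iff]
    simp [hdone]
  have := I.connected.nonempty
  obtain ⟨D', hD'⟩ := DecisionTree.exists_of_order (G := I.G) hρ Set.univ Set.univ_nonempty
    (connectedIn_univ I.connected)
  have hpw : ∀ x, (D'.queries x).Pairwise fun u v => ρ u < ρ v := fun x => (hD' x trivial).1
  have hanc : ∀ x y, y ∈ D'.queries x ↔
      Relation.ReflTransGen (fun u v => I.G.Adj u v ∧ ρ y < ρ v) y x := fun x y => by
    simpa using (hD' x trivial).2 y
  have hle : ∀ x y, y ∈ D'.queries x → ρ y ≤ ρ x := fun x y hy => by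
    rcases ((hanc x y).1 hy).cases_tail with h | ⟨z, -, -, h⟩
    · rw [h]
    · exact h.le
  -- A path from `y` through later vertices cannot leave `node y`, because every edge out of it ends
  -- before `y`.
  have hnode : ∀ x y, y ∈ D'.queries x → x ∈ node y := fun x y hy => by
    rw [hanc] at hy
    induction hy with
    | refl => exact h.mem_node y (hdone y)
    | @tail u v _ huv ih =>
      by_contra hv
      have := (h.node_closed y (hdone y) u ih v hv huv.1).2
      omega
  refine ⟨D', ?_, ?_⟩
  · rw [DecisionTree.encode]
    congr 1
    funext x y
    have hexp : ∀ z, (expand I.G.Adj s.before)^[n] Eq z x ↔ z ∈ D'.queries x := fun z => by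
      rw [iterate_expand_iff, hanc]
      simp only [hbefore]
    rw [DecisionTree.IsParent, lastBefore, List.pair_suffix_iff (hpw x) ((hanc x x).2 .refl) (hle x)]
    simp only [hexp, hbefore]
  · have h₁ : D'.cost I.c I.w ≤ ∑ y, I.c y * mass I.w (node y) := by
      calc D'.cost I.c I.w = ∑ x, I.w x * ∑ y ∈ (D'.queries x).toFinset, I.c y := by
            refine Finset.sum_congr rfl fun x _ => ?_
            rw [List.sum_toFinset _ ((hpw x).imp fun huv h => by simp [h] at huv)]
        _ ≤ ∑ x, I.w x * ∑ y, if x ∈ node y then I.c y else 0 := by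
            gcongr with x
            rw [← Finset.sum_filter]
            refine Finset.sum_le_sum_of_subset fun y hy => ?_
            simpa using hnode x y (List.mem_toFinset.1 hy)
        _ = ∑ y, I.c y * mass I.w (node y) := by
            simp only [mass_eq_sum_ite, Finset.mul_sum]
            rw [Finset.sum_comm]
            refine Finset.sum_congr rfl fun y _ => Finset.sum_congr rfl fun x _ => ?_
            split_ifs <;> ring
    have h₂ := h.cost_le
    simp only [mass_eq_sum_ite _ s.done, hdone, if_true, hs, List.map_nil, List.sum_nil,
      Nat.cast_zero, mul_zero, add_zero] at h₂
    exact le_trans (by exact_mod_cast h₁) h₂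

end SearchState

/-- The infimum is attained once some tree exists, and the order by index supplies one; for an empty
set `sInf` would be the default value 0. -/
theorem SearchInstance.exists_cost_eq_opt {n : ℕ} (I : SearchInstance n) :
    ∃ D : DecisionTree I.G Set.univ, D.cost I.c I.w = I.opt := by
  have := I.connected.nonempty
  obtain ⟨D, -⟩ := DecisionTree.exists_of_order (G := I.G) Fin.val_injective Set.univ
    Set.univ_nonempty (connectedIn_univ I.connected)
  obtain ⟨D', h⟩ := Nat.sInf_mem
    (s := {k : ℕ | ∃ D : DecisionTree I.G Set.univ, k = D.cost I.c I.w}) ⟨_, D, rfl⟩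
  exact ⟨D', h.symm⟩

theorem mainTheorem2 (f : ℕ → ℝ) (p : Program) (hp : p.PolyTime)
    (hf : p.ApproximatesMinRatioVertexCut f) :
    ∃ q : Program, q.PolyTime ∧
      q.ApproximatesGraphSearch (fun n => (12 + 4 * Real.sqrt 5) * f n) := by
  obtain ⟨out, hc, hout⟩ := p.exists_computes_proposesCuts hp hf
  obtain ⟨fin, hfin, hspec⟩ := hc.decompose hout
  have hr := Computes.refl SearchState.encode
  obtain ⟨q, P, hq⟩ := hfin.trans ((Computes.lastBefore hr.snd.snd.snd
    (Computes.iterate_expand hr.fst.fst hr.snd.snd.snd)).restrict fin)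
  refine ⟨q, ⟨P, fun n I => ⟨_, hq ⟨n, I⟩⟩⟩, fun n I => ?_⟩
  obtain ⟨D, hD⟩ := I.exists_cost_eq_opt
  obtain ⟨s, hs, ⟨ρ, N, node, hinv⟩, htodo⟩ := hspec n I
    (fun s => ∃ ρ N node, SearchState.Invariant I D (f n) s ρ N node)
    (fun s hs ⟨_, _, _, h⟩ => h.exists_step hout hs) ⟨_, _, _, .init I D (f n)⟩
  obtain ⟨D', hD', hcost⟩ := hinv.exists_decisionTree htodo
  obtain ⟨t, ht, -⟩ := hq ⟨n, I⟩
  dsimp only at ht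
  rw [hs] at ht
  refine ⟨D', t, hD' ▸ ht, hcost.trans ?_⟩
  have hκ := hout.nonneg I
  have hb : (D.budget I.c I.w Set.univ : ℝ) ≤ 2 * I.opt := by
    rw [← hD]
    exact_mod_cast D.budget_univ_le I.c I.w
  calc 16 / 3 * f n * D.budget I.c I.w Set.univ ≤ 16 / 3 * f n * (2 * I.opt) := by gcongr
    _ = 32 / 3 * (f n * I.opt) := by ring
    -- The analysis gives 32/3, already below 12.
    _ ≤ (12 + 4 * Real.sqrt 5) * (f n * I.opt) := by
      gcongr
      linarith [Real.sqrt_nonneg 5]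
    _ = (12 + 4 * Real.sqrt 5) * f n * I.opt := by ring
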